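/- Let $n\ge 1$, let $m,q\ge 0$ be integers, let $H\in\mathbb R^{m\times n}$ have rows $H_1,\dots,H_m$, and let $W_1,\dots,W_m>0$. Assume that $H$ is $2q$-observable: for every $\mathcal I\subseteq\mathcal M=\{1,\dots,m\}$ with $|\mathcal I|=m-2q$ the submatrix $H_{\mathcal I}$ of the rows in $\mathcal I$ has full column rank (in particular $m>2q$). *Model.* At time $k=1,2,\dots$ sensor $i$ measures $z_i(k)=H_ix+w_i(k)$, where $x\in\mathbb R^n$ is the unknown state and the noises $w_i(k)\sim N(0,W_i)$ are independent over $i$ and $k$. The fusion center receives $y(k)=z(k)+a(k)$. For a set $\mathcal C\subseteq\mathcal M$ of compromised sensors with $|\mathcal C|=q$, an attack strategy $g$ draws $a(k)\in\mathbb R^m$ from a probability measure that may depend on $x$, $\mathcal C$, the estimator, $z_i(j)$ for $i\in\mathcal C$, $j\le k$, and $a(j)$ for $j<k$, and is such that $a_i(k)=0$ for $i\notin\mathcal C$. Put $Y(k)=(y(1),\dots,y(k))$ and $\operatorname{avg}(Y(k))=\frac1k\sum_{j\le k}y(j)\in\mathbb R^m$. For a (deterministic) estimator $f$, with estimate $\hat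 x_k=f_k(Y(k))\in\mathbb R^n$, and $\delta>0$ let $$e(f,k,\delta)=\sup_{\mathcal C,\,g,\,x}\mathbb P_{g,x,\mathcal C}\bigl(\|\hat x_k-x\|_2>\delta\bigr),\qquad r(f,\delta)=\liminf_{k\to\infty}-\frac{\log e(f,k,\delta)}{k}\in[0,\infty].$$ *Sets and centers.* For $A\subseteq\mathbb R^n$ let $\operatorname{dist}(c,A)=\sup_{x\in A}\|x-c\|_2$ and $\operatorname{rad}(A)=\inf_c\operatorname{dist}(c,A)$ (so $\operatorname{rad}(\emptyset)=0$); a Chebyshev center of $A$ is a minimizer $c$ of $\operatorname{dist}(\cdot,A)$. For $y\in\mathbb R^m$ and $x\in\mathbb R^n$ let $d_x(y)$ be the minimum of $\frac12\sum_{i=1}^m(y_i-H_ix+a_i)^2/W_i$ over all $a\in\mathbb R^m$ with at most $q$ nonzero entries. Let $\mathcal X(y,\phi)=\{x:d_x(y)\le\phi\}$, and let $\mathbb X(y,\delta)$ be the union of all $\mathcal X(y,\phi)$ with $\phi\ge0$ and $\operatorname{rad}(\mathcal X(y,\phi))\le\delta$. Let $f^*_\delta$ be an estimator whose estimate at time $k$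 is a Chebyshev center of $\mathbb X(\operatorname{avg}(Y(k)),\delta)$, given by a function of $\operatorname{avg}(Y(k))$ that does not depend on $k$ (its value is arbitrary where $\mathbb X(\operatorname{avg}(Y(k)),\delta)=\emptyset$). *Algorithm.* For $|\mathcal I|=m-q$ put $W_{\{\mathcal I\}}=\operatorname{diag}(W_i)_{i\in\mathcal I}$, $\kappa_{\mathcal I}=(H_{\mathcal I}^\top W_{\{\mathcal I\}}^{-1}H_{\mathcal I})^{-1}H_{\mathcal I}^\top W_{\{\mathcal I\}}^{-1}$ and $\operatorname{res}(\mathcal I)=\frac12(y_{\mathcal I}-H_{\mathcal I}\kappa_{\mathcal I}y_{\mathcal I})^\top W_{\{\mathcal I\}}^{-1}(y_{\mathcal I}-H_{\mathcal I}\kappa_{\mathcal I}y_{\mathcal I})$, and let $\Upsilon=\min_{|\mathcal I|=m-q}\operatorname{res}(\mathcal I)$. On input $y\in\mathbb R^m$, with threshold $\delta>0$ and tolerance $\varepsilon>0$, start with $\underline\phi=\Upsilon$ and any $\overline\phi$ such that $\operatorname{rad}(\mathcal X(y,\overline\phi))>\delta$, and repeat: 1. If $\overline\phi-\underline\phi<\varepsilon/2$,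 return the Chebyshev center of $\mathcal X(y,\max\{\Upsilon,\underline\phi-\varepsilon/2\})$ and stop. 2. Otherwise let $\phi=(\underline\phi+\overline\phi)/2$. If $\operatorname{rad}(\mathcal X(y,\phi))=\delta$, return the Chebyshev center of $\mathcal X(y,\phi)$ and stop; if $\operatorname{rad}(\mathcal X(y,\phi))>\delta$, set $\overline\phi=\phi$; if $\operatorname{rad}(\mathcal X(y,\phi))<\delta$, set $\underline\phi=\phi$. **Theorem.** Let $\delta>0$ and $\varepsilon>0$. (a) For every $y$ with $\mathbb X(y,\delta)\ne\emptyset$, the set $\mathbb X(y,\delta)$ has exactly one Chebyshev center. (b) For every $y$ an admissible initial $\overline\phi$ exists, and from every admissible initial $\overline\phi$ the algorithm stops after finitely many rounds with a unique output. (c) Let $\hat f(y,\varepsilon)$ be the output of the algorithm on input $y$ (with any admissible choice of the initial $\overline\phi$ for each $y$), and let $\hat f_\varepsilon(Y(k))=\hat f(\operatorname{avg}(Y(k)),\varepsilon)$. Then $$r(\hat f_\varepsilon,\delta)\ \ge\ r(f^*_\delta,\delta)-\varepsilon .$$ -/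

import Mathlib

open MeasureTheory ProbabilityTheory Filter Topology
open scoped Matrix ENNReal

noncomputable section

namespace SecureEstimation

/-- The state space `ℝⁿ` with its Euclidean norm. -/
abbrev State (n : ℕ) : Type := EuclideanSpace ℝ (Fin n)

/-- A record of `k` consecutive vectors in `ℝᵐ`, that is, an `m × k` matrix stored by columns:
`Y j i` is the entry of sensor `i` at the `j`-th time instant (the times are `1, …, k`). -/
abbrev Record (m k : ℕ) : Type := Fin k → Fin m → ℝ

/-! ### Chebyshev radius and Chebyshev centers -/

/-- The distance `sup {‖x - c‖ : x ∈ A}` of a point to (the farthest point of) a set. -/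
def farDist {n : ℕ} (c : State n) (A : Set (State n)) : ℝ≥0∞ := ⨆ x ∈ A, edist x c

/-- The Chebyshev radius; it is `0` for the empty set and `∞` for unbounded sets. -/
def rad {n : ℕ} (A : Set (State n)) : ℝ≥0∞ := ⨅ c : State n, farDist c A

/-- `c` minimizes the distance to `A`. -/
def IsChebyshevCenter {n : ℕ} (A : Set (State n)) (c : State n) : Prop :=
  ∀ c' : State n, farDist c A ≤ farDist c' A

/-! ### Observability, inconsistency, residues -/

/-- The rows of `H` with index in `I`. -/
def rows {m n : ℕ} (H : Matrix (Fin m) (Fin n) ℝ) (I : Finset (Fin m)) : Matrix I (Fin n) ℝ :=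
  H.submatrix (fun i : I => (i : Fin m)) id

/-- `H` is `s`-observable: after the removal of any `s` rows it still has full column rank. -/
def SparseObservable {m n : ℕ} (H : Matrix (Fin m) (Fin n) ℝ) (s : ℕ) : Prop :=
  ∀ I : Finset (Fin m), I.card = m - s → (rows H I).rank = n

/-- The inconsistency `d_x(y)`: the infimum of `½ ∑ᵢ (yᵢ - Hᵢ x + aᵢ)² / Wᵢ` over all `a ∈ ℝᵐ` with
at most `q` nonzero entries. -/
def inconsistency {m n : ℕ} (H : Matrix (Fin m) (Fin n) ℝ) (W : Fin m → ℝ) (q : ℕ)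
    (y : Fin m → ℝ) (x : State n) : ℝ :=
  ⨅ a : {a : Fin m → ℝ // hammingNorm a ≤ q},
    (1 / 2) * ∑ i, (y i - (H *ᵥ x.ofLp) i + a.1 i) ^ 2 / W i

/-- The set `𝒳(y, φ)` of the states whose inconsistency with `y` is at most `φ`. -/
def levelSet {m n : ℕ} (H : Matrix (Fin m) (Fin n) ℝ) (W : Fin m → ℝ) (q : ℕ)
    (y : Fin m → ℝ) (φ : ℝ) : Set (State n) :=
  {x | inconsistency H W q y x ≤ φ}

/-- The set `𝕏(y, δ)`: the union of all `𝒳(y, φ)`, `φ ≥ 0`, of radius at most `δ`. -/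
def maxLevelSet {m n : ℕ} (H : Matrix (Fin m) (Fin n) ℝ) (W : Fin m → ℝ) (q : ℕ)
    (y : Fin m → ℝ) (δ : ℝ) : Set (State n) :=
  {x | ∃ φ : ℝ, 0 ≤ φ ∧ rad (levelSet H W q y φ) ≤ ENNReal.ofReal δ ∧ x ∈ levelSet H W q y φ}

/-- The diagonal covariance matrix of the sensors in `I`. -/
def cov {m : ℕ} (W : Fin m → ℝ) (I : Finset (Fin m)) : Matrix I I ℝ :=
  Matrix.diagonal fun i => W i

/-- The weighted least squares matrix `κ_I = (H_Iᵀ W_I⁻¹ H_I)⁻¹ H_Iᵀ W_I⁻¹`. -/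
def lsMatrix {m n : ℕ} (H : Matrix (Fin m) (Fin n) ℝ) (W : Fin m → ℝ) (I : Finset (Fin m)) :
    Matrix (Fin n) I ℝ :=
  ((rows H I)ᵀ * (cov W I)⁻¹ * rows H I)⁻¹ * (rows H I)ᵀ * (cov W I)⁻¹

/-- The vector `y_I - H_I κ_I y_I`. -/
def lsError {m n : ℕ} (H : Matrix (Fin m) (Fin n) ℝ) (W : Fin m → ℝ)
    (y : Fin m → ℝ) (I : Finset (Fin m)) : I → ℝ :=
  (fun i : I => y i) - rows H I *ᵥ (lsMatrix H W I *ᵥ fun i : I => y i)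

/-- The residue `res(I) = ½ (y_I - H_I κ_I y_I)ᵀ W_I⁻¹ (y_I - H_I κ_I y_I)`. -/
def residue {m n : ℕ} (H : Matrix (Fin m) (Fin n) ℝ) (W : Fin m → ℝ)
    (y : Fin m → ℝ) (I : Finset (Fin m)) : ℝ :=
  (1 / 2) * (lsError H W y I ⬝ᵥ ((cov W I)⁻¹ *ᵥ lsError H W y I))

/-- `Υ`: the smallest residue over the index sets with `m - q` elements. -/
def minResidue {m n : ℕ} (H : Matrix (Fin m) (Fin n) ℝ) (W : Fin m → ℝ) (q : ℕ)
    (y : Fin m → ℝ) : ℝ :=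
  ⨅ I : {I : Finset (Fin m) // I.card = m - q}, residue H W y I.1

/-! ### The modified bisection algorithm -/

/-- `BisectionOutput H W q δ ε y lo hi x`: the loop of the modified bisection algorithm, entered with
the lower value `lo` and the upper value `hi`, stops after finitely many rounds and returns `x`. -/
inductive BisectionOutput {m n : ℕ} (H : Matrix (Fin m) (Fin n) ℝ) (W : Fin m → ℝ) (q : ℕ)
    (δ ε : ℝ) (y : Fin m → ℝ) : ℝ → ℝ → State n → Prop
  | tolerance {lo hi : ℝ} {x : State n} (hgap : hi - lo < ε / 2)
      (hx : IsChebyshevCenter (levelSet H W q y (max (minResidue H W q y) (lo - ε / 2))) x) :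
      BisectionOutput H W q δ ε y lo hi x
  | exact {lo hi : ℝ} {x : State n} (hgap : ¬ hi - lo < ε / 2)
      (hrad : rad (levelSet H W q y ((lo + hi) / 2)) = ENNReal.ofReal δ)
      (hx : IsChebyshevCenter (levelSet H W q y ((lo + hi) / 2)) x) :
      BisectionOutput H W q δ ε y lo hi x
  | decreaseUpper {lo hi : ℝ} {x : State n} (hgap : ¬ hi - lo < ε / 2)
      (hrad : ENNReal.ofReal δ < rad (levelSet H W q y ((lo + hi) / 2)))
      (hnext : BisectionOutput H W q δ ε y lo ((lo + hi) / 2) x) :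
      BisectionOutput H W q δ ε y lo hi x
  | increaseLower {lo hi : ℝ} {x : State n} (hgap : ¬ hi - lo < ε / 2)
      (hrad : rad (levelSet H W q y ((lo + hi) / 2)) < ENNReal.ofReal δ)
      (hnext : BisectionOutput H W q δ ε y ((lo + hi) / 2) hi x) :
      BisectionOutput H W q δ ε y lo hi x

/-- An admissible initial upper value for the bisection: one with `rad 𝒳(y, φ) > δ`. -/
def IsInitialUpper {m n : ℕ} (H : Matrix (Fin m) (Fin n) ℝ) (W : Fin m → ℝ) (q : ℕ)
    (δ : ℝ) (y : Fin m → ℝ) (φ : ℝ) : Prop :=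
  ENNReal.ofReal δ < rad (levelSet H W q y φ)

/-- `AlgorithmOutput H W q δ ε y hi x`: on input `y`, with tolerance `ε` and initial upper value
`hi`, the algorithm stops and returns `x`. -/
def AlgorithmOutput {m n : ℕ} (H : Matrix (Fin m) (Fin n) ℝ) (W : Fin m → ℝ) (q : ℕ)
    (δ ε : ℝ) (y : Fin m → ℝ) (hi : ℝ) (x : State n) : Prop :=
  BisectionOutput H W q δ ε y (minResidue H W q y) hi x

/-! ### Attacks and the law of the measurements -/

/-- An attack strategy on the set `C` of compromised sensors. Its bias at time `k + 1` is drawn from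
a probability measure on `ℝᵐ` that may depend on the uncorrupted measurements of the compromised
sensors at the times `1, …, k + 1` and on the biases at the times `1, …, k`; benign sensors get
bias `0`. (The true state and the estimator are known to the attacker: the strategy is
chosen after them.) -/
structure AttackStrategy {m : ℕ} (C : Finset (Fin m)) where
  bias : ∀ k : ℕ, Kernel ((Fin (k + 1) → C → ℝ) × Record m k) (Fin m → ℝ)
  isMarkov : ∀ k, IsMarkovKernel (bias k)
  sparse : ∀ k h, ∀ᵐ a ∂(bias k h), ∀ i, i ∉ C → a i = 0

/-- The law of the uncorrupted measurement `z = H x + w` at one time instant, with independent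
`wᵢ ∼ N(0, Wᵢ)`. -/
def sensorLaw {m n : ℕ} (H : Matrix (Fin m) (Fin n) ℝ) (W : Fin m → ℝ) (x : State n) :
    Measure (Fin m → ℝ) :=
  Measure.pi fun i => gaussianReal ((H *ᵥ x.ofLp) i) (W i).toNNReal

/-- What the attacker sees when it chooses its bias at time `k + 1`, given the past uncorrupted
measurements and biases and the new uncorrupted measurement. -/
def attackerView {m : ℕ} (C : Finset (Fin m)) (k : ℕ)
    (p : (Record m k × Record m k) × (Fin m → ℝ)) :
    (Fin (k + 1) → C → ℝ) × Record m k :=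
  (fun j i => (Fin.snoc p.1.1 p.2 : Record m (k + 1)) j i, p.1.2)

lemma measurable_attackerView {m : ℕ} (C : Finset (Fin m)) (k : ℕ) :
    Measurable (attackerView C k) := by
  refine Measurable.prodMk ?_ (by fun_prop)
  refine measurable_pi_lambda _ fun j => measurable_pi_lambda _ fun i => ?_
  refine Fin.lastCases ?_ (fun j => ?_) j
  · simp only [Fin.snoc_last]; fun_prop
  · simp only [Fin.snoc_castSucc]; fun_prop

/-- The joint law of the uncorrupted measurements and the biases at the times `1, …, k`. -/
def jointLaw {m n : ℕ} (H : Matrix (Fin m) (Fin n) ℝ) (W : Fin m → ℝ) {C : Finset (Fin m)}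
    (g : AttackStrategy C) (x : State n) : ∀ k : ℕ, Measure (Record m k × Record m k)
  | 0 => Measure.dirac (Fin.elim0, Fin.elim0)
  | k + 1 =>
    (((jointLaw H W g x k).prod (sensorLaw H W x)) ⊗ₘ
        ((g.bias k).comap (attackerView C k) (measurable_attackerView C k))).map
      fun p => (Fin.snoc p.1.1.1 p.1.2, Fin.snoc p.1.1.2 p.2)

/-- The law of the received measurements `y = z + a` at the times `1, …, k`. -/
def measurementLaw {m n : ℕ} (H : Matrix (Fin m) (Fin n) ℝ) (W : Fin m → ℝ) {C : Finset (Fin m)}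
    (g : AttackStrategy C) (x : State n) (k : ℕ) : Measure (Record m k) :=
  (jointLaw H W g x k).map fun p => p.1 + p.2

/-! ### Estimators and their performance -/

/-- A (deterministic) estimator: an estimate of the state from the measurements up to time `k`. -/
abbrev Estimator (m n : ℕ) : Type := ∀ k : ℕ, Record m k → State n

/-- The average over time of each sensor's measurements. -/
def avg {m k : ℕ} (Y : Record m k) : Fin m → ℝ := fun i => (∑ j, Y j i) / k

/-- The estimator that applies `h` to the averaged measurements at every time. -/
def ofAvg {m n : ℕ} (h : (Fin m → ℝ) → State n) : Estimator m n := fun _ Y => h (avg Y)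

/-- The worst-case error probability `e(f, k, δ)`: the supremum of `ℙ(‖x̂ₖ - x‖ > δ)` over all sets of
`q` compromised sensors, all attack strategies on them and all states. (If the error event fails to
be measurable, its outer probability is taken.) -/
def worstError {m n : ℕ} (H : Matrix (Fin m) (Fin n) ℝ) (W : Fin m → ℝ) (q : ℕ)
    (f : Estimator m n) (k : ℕ) (δ : ℝ) : ℝ≥0∞ :=
  ⨆ (C : Finset (Fin m)) (_ : C.card = q) (g : AttackStrategy C) (x : State n),
    measurementLaw H W g x k {Y | δ < ‖f k Y - x‖}

/-- The rate `r(f, δ) = liminf_{k → ∞} - log e(f, k, δ) / k`, with `log 0 = -∞`. -/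
def rate {m n : ℕ} (H : Matrix (Fin m) (Fin n) ℝ) (W : Fin m → ℝ) (q : ℕ)
    (f : Estimator m n) (δ : ℝ) : EReal :=
  liminf (fun k : ℕ => (-(ENNReal.log (worstError H W q f k δ))) / (k : EReal)) atTop

end SecureEstimation

end

noncomputable section

namespace SecureEstimation

/-! ### Chebyshev radius and centers -/

/-! The link between the two estimators is a converse bound valid for every estimator: if `rad 𝒳(y,
φ) > δ` for some `y`, then no rate exceeds `φ` (`rate_le_of_isInitialUpper`). By compactness,
finitely many states of `𝒳(y, φ)` already fit in no closed `δ`-ball, so every estimate is `δ`-far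
from one of them. For each such state a constant attack makes the measurements i.i.d. Gaussian with
a mean at quadratic distance at most `φ` from `y` (`exists_constant_bias`). Passing from mean `y` to
that mean costs a factor `exp(-k(φ + η))` on typical events (`gaussianRecord_change_mean`), and a
union bound over the finite set forces a worst error of this order.

Conversely, suppose an estimator based on averages errs only at states of inconsistency at least
`J`. Its rate is then at least `J` (`le_rate_ofAvg`): the residual of the benign sensors is
unaffected by the attack, it dominates the inconsistency of the true state, and a Chernoff bound
controls it.

It remains to look at the bisection. Let `R` be the rate of `f*`. By the converse, `R` lies below
every level whose radius exceeds `δ`. The loop invariants then show that a state `δ`-far from the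
output has inconsistency at least `R - ε` (`BisectionOutput.le_inconsistency_add`), and the direct
bound with `J = R - ε` finishes the proof.

Observability makes all level sets compact, hence their radii finite and strictly increasing in the
level (`rad_levelSet_lt`). Existence and uniqueness of Chebyshev centers of nonempty bounded sets
come from semicontinuity and the parallelogram law. -/

lemma farDist_le_iff {n : ℕ} {c : State n} {A : Set (State n)} {r : ℝ≥0∞} :
    farDist c A ≤ r ↔ ∀ x ∈ A, edist x c ≤ r := by
  simp [farDist]

lemma farDist_mono {n : ℕ} (c : State n) {A B : Set (State n)} (h : A ⊆ B) :
    farDist c A ≤ farDist c B :=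
  farDist_le_iff.2 fun x hx => farDist_le_iff.1 le_rfl x (h hx)

lemma rad_mono {n : ℕ} {A B : Set (State n)} (h : A ⊆ B) : rad A ≤ rad B :=
  iInf_mono fun c => farDist_mono c h

lemma rad_empty {n : ℕ} : rad (∅ : Set (State n)) = 0 := by
  refine le_antisymm ((iInf_le _ 0).trans ?_) bot_le
  simp [farDist]

lemma nonempty_of_rad_pos {n : ℕ} {A : Set (State n)} (h : 0 < rad A) : A.Nonempty := by
  by_contra hA
  rw [Set.not_nonempty_iff_eq_empty] at hA
  simp [hA, rad_empty] at h

lemma IsChebyshevCenter.farDist_eq {n : ℕ} {A : Set (State n)} {c : State n}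
    (h : IsChebyshevCenter A c) : farDist c A = rad A :=
  le_antisymm (le_iInf h) (iInf_le _ c)

lemma IsChebyshevCenter.norm_sub_le {n : ℕ} {A : Set (State n)} {c x : State n} {δ : ℝ}
    (hδ : 0 ≤ δ) (h : IsChebyshevCenter A c) (hA : rad A ≤ ENNReal.ofReal δ) (hx : x ∈ A) :
    ‖c - x‖ ≤ δ := by
  rw [← h.farDist_eq, farDist_le_iff] at hA
  have := hA x hx
  rw [edist_dist, ENNReal.ofReal_le_ofReal_iff hδ, dist_comm, dist_eq_norm] at this
  exact this

lemma farDist_lt_top {n : ℕ} {A : Set (State n)} (hA : Bornology.IsBounded A) (c : State n) :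
    farDist c A < ∞ := by
  obtain ⟨r, hr⟩ := hA.subset_closedBall c
  refine lt_of_le_of_lt (farDist_le_iff.2 fun x hx => ?_) (ENNReal.ofReal_lt_top (r := r))
  rw [edist_dist]
  exact ENNReal.ofReal_le_ofReal (Metric.mem_closedBall.1 (hr hx))

lemma rad_lt_top {n : ℕ} {A : Set (State n)} (hA : Bornology.IsBounded A) : rad A < ∞ :=
  (iInf_le _ 0).trans_lt (farDist_lt_top hA 0)

lemma lowerSemicontinuous_farDist {n : ℕ} (A : Set (State n)) :
    LowerSemicontinuous fun c => farDist c A :=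
  lowerSemicontinuous_biSup fun _ _ =>
    Continuous.lowerSemicontinuous (continuous_const.edist continuous_id)

/-- A lower semicontinuous function attains its minimum on a compact ball around some `x₀ ∈ A`. With
radius `farDist x₀ A`, any point outside the ball is already worse than `x₀`, because of its
distance to `x₀` alone. -/
lemma exists_isChebyshevCenter {n : ℕ} {A : Set (State n)} (hA : Bornology.IsBounded A)
    (hne : A.Nonempty) : ∃ c, IsChebyshevCenter A c := by
  obtain ⟨x₀, hx₀⟩ := hne
  set r := (farDist x₀ A).toReal with hr
  have hr' : farDist x₀ A = ENNReal.ofReal r :=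
    (ENNReal.ofReal_toReal (farDist_lt_top hA x₀).ne).symm
  obtain ⟨c, -, hc⟩ := LowerSemicontinuousOn.exists_isMinOn
    (Metric.nonempty_closedBall.2 (ENNReal.toReal_nonneg (a := farDist x₀ A)))
    (isCompact_closedBall x₀ r) ((lowerSemicontinuous_farDist A).lowerSemicontinuousOn _)
  refine ⟨c, fun c' => ?_⟩
  by_cases hc' : c' ∈ Metric.closedBall x₀ r
  · exact hc hc'
  · refine (hc (Metric.mem_closedBall_self ENNReal.toReal_nonneg)).trans ?_
    refine le_trans ?_ (farDist_le_iff.1 le_rfl x₀ hx₀)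
    change farDist x₀ A ≤ _
    rw [hr', edist_dist, dist_comm]
    exact ENNReal.ofReal_le_ofReal (not_le.1 hc').le

/-- By the parallelogram law, the midpoint of two distinct centers would have a strictly smaller
farthest distance `s` than the radius `r`. -/
lemma IsChebyshevCenter.unique {n : ℕ} {A : Set (State n)} (hA : Bornology.IsBounded A)
    (hne : A.Nonempty) {c₁ c₂ : State n} (h₁ : IsChebyshevCenter A c₁)
    (h₂ : IsChebyshevCenter A c₂) : c₁ = c₂ := by
  by_contra hne'
  set r := (rad A).toReal with hr
  have hr' : rad A = ENNReal.ofReal r := (ENNReal.ofReal_toReal (rad_lt_top hA).ne).symm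
  have hr0 : 0 ≤ r := ENNReal.toReal_nonneg
  have hd : 0 < ‖c₁ - c₂‖ := norm_pos_iff.2 (sub_ne_zero.2 hne')
  set s := Real.sqrt (r ^ 2 - ‖c₁ - c₂‖ ^ 2 / 4) with hs
  have key : ∀ x ∈ A, ‖x - midpoint ℝ c₁ c₂‖ ^ 2 ≤ r ^ 2 - ‖c₁ - c₂‖ ^ 2 / 4 := by
    intro x hx
    have e₁ := h₁.norm_sub_le hr0 hr'.le hx
    have e₂ := h₂.norm_sub_le hr0 hr'.le hx
    have hpl := parallelogram_law_with_norm ℝ (c₁ - x) (c₂ - x)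
    have hm : c₁ - x + (c₂ - x) = (-2 : ℝ) • (x - midpoint ℝ c₁ c₂) := by
      rw [midpoint_eq_smul_add]
      ext i
      simp
      ring
    rw [hm, norm_smul, sub_sub_sub_cancel_right] at hpl
    norm_num at hpl
    have q₁ := pow_le_pow_left₀ (norm_nonneg _) e₁ 2
    have q₂ := pow_le_pow_left₀ (norm_nonneg _) e₂ 2
    nlinarith
  have hle : farDist (midpoint ℝ c₁ c₂) A ≤ ENNReal.ofReal s := farDist_le_iff.2 fun x hx => by
    rw [edist_dist, dist_eq_norm]
    exact ENNReal.ofReal_le_ofReal (Real.le_sqrt_of_sq_le (key x hx))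
  obtain ⟨x, hx⟩ := hne
  have hnn : 0 ≤ r ^ 2 - ‖c₁ - c₂‖ ^ 2 / 4 := (sq_nonneg _).trans (key x hx)
  have hlt : s < r := by
    rw [hs, Real.sqrt_lt hnn hr0]
    nlinarith
  have : ENNReal.ofReal s < ENNReal.ofReal r :=
    (ENNReal.ofReal_lt_ofReal_iff (lt_of_le_of_lt (Real.sqrt_nonneg _) hlt)).2 hlt
  exact absurd ((h₁ _).trans hle) (not_le.2 (by rwa [h₁.farDist_eq, hr']))

lemma existsUnique_isChebyshevCenter {n : ℕ} {A : Set (State n)} (hA : Bornology.IsBounded A)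
    (hne : A.Nonempty) : ∃! c, IsChebyshevCenter A c := by
  obtain ⟨c, hc⟩ := exists_isChebyshevCenter hA hne
  exact ⟨c, hc, fun c' hc' => IsChebyshevCenter.unique hA hne hc' hc⟩

/-- A set of radius larger than `δ` has a finite subset that no closed `δ`-ball contains. -/
lemma exists_finset_of_lt_rad {n : ℕ} {A : Set (State n)} {δ : ℝ} (hδ : 0 ≤ δ)
    (hA : ENNReal.ofReal δ < rad A) :
    ∃ F : Finset (State n), (∀ x ∈ F, x ∈ A) ∧ ∀ c, ∃ x ∈ F, δ < ‖c - x‖ := by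
  classical
  have far : ∀ c, ∃ x ∈ A, δ < ‖c - x‖ := by
    intro c
    have : ¬ farDist c A ≤ ENNReal.ofReal δ := not_le.2 (hA.trans_le (iInf_le _ c))
    rw [farDist_le_iff] at this
    push Not at this
    obtain ⟨x, hx, hlt⟩ := this
    refine ⟨x, hx, ?_⟩
    rw [edist_dist, dist_comm, dist_eq_norm] at hlt
    exact (ENNReal.ofReal_lt_ofReal_iff_of_nonneg hδ).1 hlt
  obtain ⟨x₀, hx₀, -⟩ := far 0
  -- Only candidate centers within `δ` of `x₀` need compactness; for all others `x₀` itself is the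
  -- far point.
  obtain ⟨t, ht⟩ := (isCompact_closedBall x₀ δ).elim_finite_subcover
    (fun x : A => {c : State n | δ < ‖c - x‖})
    (fun x => isOpen_lt continuous_const (continuous_id.sub continuous_const).norm)
    (fun c _ => by
      obtain ⟨x, hx, h⟩ := far c
      exact Set.mem_iUnion.2 ⟨⟨x, hx⟩, h⟩)
  refine ⟨insert x₀ (t.image Subtype.val), fun x hx => ?_, fun c => ?_⟩
  · rcases Finset.mem_insert.1 hx with rfl | hx
    · exact hx₀
    · obtain ⟨z, -, rfl⟩ := Finset.mem_image.1 hx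
      exact z.2
  · by_cases hc : c ∈ Metric.closedBall x₀ δ
    · obtain ⟨x, hx, h⟩ := Set.mem_iUnion₂.1 (ht hc)
      exact ⟨x, Finset.mem_insert_of_mem (Finset.mem_image_of_mem _ hx), h⟩
    · exact ⟨x₀, Finset.mem_insert_self _ _, by simpa [dist_eq_norm] using hc⟩

lemma exists_unit_smul {n : ℕ} (hn : 0 < n) (v : State n) :
    ∃ u : State n, ‖u‖ = 1 ∧ v = ‖v‖ • u := by
  by_cases hv : v = 0
  · refine ⟨EuclideanSpace.single ⟨0, hn⟩ 1, by simp, by simp [hv]⟩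
  · refine ⟨‖v‖⁻¹ • v, norm_smul_inv_norm (𝕜 := ℝ) hv, ?_⟩
    rw [smul_smul, mul_inv_cancel₀ (norm_ne_zero_iff.2 hv), one_smul]

/-- For any center `c`, moving a point of `A` by `η` straight away from `c` stays in `B`, so every
farthest distance grows by at least `η`. Finiteness of `rad A` makes the inequality strict. -/
lemma rad_lt_rad_of_cthickening_subset {n : ℕ} (hn : 0 < n) {A B : Set (State n)} {η : ℝ}
    (hη : 0 < η) (hA : Bornology.IsBounded A) (hne : A.Nonempty)
    (h : Metric.cthickening η A ⊆ B) : rad A < rad B := by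
  have hle : rad A + ENNReal.ofReal η ≤ rad B := by
    refine le_iInf fun c => (add_le_add_left (iInf_le _ c) _).trans ?_
    rw [farDist, ENNReal.biSup_add' hne]
    refine iSup₂_le fun x hx => ?_
    obtain ⟨u, hu, hxu⟩ := exists_unit_smul hn (x - c)
    have hz : x + η • u ∈ B := by
      refine h (Metric.mem_cthickening_of_dist_le _ x η A hx ?_)
      simp [dist_eq_norm, norm_smul, hu, abs_of_pos hη]
    refine le_trans (le_of_eq ?_) (farDist_le_iff.1 le_rfl _ hz)
    have : x + η • u - c = (‖x - c‖ + η) • u := by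
      rw [add_smul, ← hxu]; abel
    rw [edist_dist, edist_dist, ← ENNReal.ofReal_add dist_nonneg hη.le, dist_eq_norm, dist_eq_norm,
      this, norm_smul, hu, mul_one, Real.norm_of_nonneg (by positivity)]
  exact (ENNReal.lt_add_right (rad_lt_top hA).ne (by simpa using hη)).trans_le hle

lemma le_rad_of_mem_of_neg_mem {n : ℕ} {A : Set (State n)} {v : State n} (hv : v ∈ A)
    (hv' : -v ∈ A) : ENNReal.ofReal ‖v‖ ≤ rad A := by
  refine le_iInf fun c => ?_
  have h₁ := farDist_le_iff.1 (le_refl (farDist c A)) v hv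
  have h₂ := farDist_le_iff.1 (le_refl (farDist c A)) _ hv'
  rw [edist_dist, dist_eq_norm] at h₁ h₂
  have : ‖v‖ ≤ max ‖v - c‖ ‖-v - c‖ := by
    have e : (2 : ℝ) • v = (v - c) - (-v - c) := by rw [two_smul]; abel
    have := norm_sub_le (v - c) (-v - c)
    rw [← e, norm_smul] at this
    norm_num at this
    rcases le_total ‖v - c‖ ‖-v - c‖ with h | h
    · exact le_max_of_le_right (by linarith)
    · exact le_max_of_le_left (by linarith)
  rcases le_max_iff.1 this with h | h
  · exact (ENNReal.ofReal_le_ofReal h).trans h₁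
  · exact (ENNReal.ofReal_le_ofReal h).trans h₂

/-! ### Inconsistency and its level sets -/

/-- The weighted squared residual of the sensors outside `C`. -/
def residualOff {m n : ℕ} (H : Matrix (Fin m) (Fin n) ℝ) (W : Fin m → ℝ) (C : Finset (Fin m))
    (y : Fin m → ℝ) (x : State n) : ℝ :=
  (1 / 2) * ∑ i ∈ Cᶜ, (y i - (H *ᵥ x.ofLp) i) ^ 2 / W i

section LevelSets

variable {m n q : ℕ} {H : Matrix (Fin m) (Fin n) ℝ} {W : Fin m → ℝ}

lemma residualOff_nonneg (hW : ∀ i, 0 < W i) (C : Finset (Fin m)) (y : Fin m → ℝ) (x : State n) :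
    0 ≤ residualOff H W C y x :=
  mul_nonneg (by norm_num) (Finset.sum_nonneg fun i _ => div_nonneg (sq_nonneg _) (hW i).le)

lemma residualOff_anti (hW : ∀ i, 0 < W i) {C D : Finset (Fin m)} (h : C ⊆ D) (y : Fin m → ℝ)
    (x : State n) : residualOff H W D y x ≤ residualOff H W C y x := by
  refine mul_le_mul_of_nonneg_left ?_ (by norm_num)
  exact Finset.sum_le_sum_of_subset_of_nonneg (Finset.compl_subset_compl.2 h)
    fun i _ _ => div_nonneg (sq_nonneg _) (hW i).le

lemma bddBelow_range_inconsistency (hW : ∀ i, 0 < W i) (y : Fin m → ℝ) (x : State n) :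
    BddBelow (Set.range fun a : {a : Fin m → ℝ // hammingNorm a ≤ q} =>
      (1 / 2) * ∑ i, (y i - (H *ᵥ x.ofLp) i + a.1 i) ^ 2 / W i) := by
  refine ⟨0, ?_⟩
  rintro _ ⟨a, rfl⟩
  exact mul_nonneg (by norm_num) (Finset.sum_nonneg fun i _ => div_nonneg (sq_nonneg _) (hW i).le)

lemma inconsistency_le_residualOff (hW : ∀ i, 0 < W i) {C : Finset (Fin m)} (hC : C.card ≤ q)
    (y : Fin m → ℝ) (x : State n) : inconsistency H W q y x ≤ residualOff H W C y x := by
  classical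
  let a : Fin m → ℝ := fun i => if i ∈ C then (H *ᵥ x.ofLp) i - y i else 0
  have ha : hammingNorm a ≤ q := by
    refine le_trans (Finset.card_le_card fun i hi => ?_) hC
    by_contra hiC
    simp [a, hiC] at hi
  refine (ciInf_le (bddBelow_range_inconsistency hW y x) ⟨a, ha⟩).trans (le_of_eq ?_)
  simp only [residualOff]
  congr 1
  rw [← Finset.sum_compl_add_sum C]
  have : ∑ i ∈ C, (y i - (H *ᵥ x.ofLp) i + a i) ^ 2 / W i = 0 :=
    Finset.sum_eq_zero fun i hi => by simp [a, hi]
  rw [this, add_zero]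
  refine Finset.sum_congr rfl fun i hi => ?_
  simp [a, Finset.mem_compl.1 hi]

/-- The support of `a` is enlarged to exactly `q` sensors; outside it `a` vanishes, and the
remaining terms are nonnegative and can be dropped. -/
lemma exists_residualOff_le (hW : ∀ i, 0 < W i) (hq : q ≤ m) (y : Fin m → ℝ) (x : State n)
    {a : Fin m → ℝ} (ha : hammingNorm a ≤ q) :
    ∃ C : Finset (Fin m), C.card = q ∧
      residualOff H W C y x ≤ (1 / 2) * ∑ i, (y i - (H *ᵥ x.ofLp) i + a i) ^ 2 / W i := by
  classical
  obtain ⟨C, hsub, hC⟩ := Finset.exists_superset_card_eq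
    (s := Finset.univ.filter fun i => a i ≠ 0) ha (by simpa using hq)
  refine ⟨C, hC, mul_le_mul_of_nonneg_left ?_ (by norm_num)⟩
  calc ∑ i ∈ Cᶜ, (y i - (H *ᵥ x.ofLp) i) ^ 2 / W i
      = ∑ i ∈ Cᶜ, (y i - (H *ᵥ x.ofLp) i + a i) ^ 2 / W i := by
        refine Finset.sum_congr rfl fun i hi => ?_
        have : a i = 0 := by
          by_contra h
          exact Finset.mem_compl.1 hi (hsub (by simpa using h))
        rw [this, add_zero]
    _ ≤ _ := Finset.sum_le_sum_of_subset_of_nonneg (Finset.subset_univ _)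
        fun i _ _ => div_nonneg (sq_nonneg _) (hW i).le

lemma powersetCard_nonempty (hq : q ≤ m) :
    (Finset.powersetCard q (Finset.univ : Finset (Fin m))).Nonempty :=
  Finset.powersetCard_nonempty.2 (by simpa using hq)

/-- An optimal bias cancels the residuals of the sensors it touches, so only the choice of those
sensors matters. A minimum over finitely many quadratics is attained and continuous. -/
lemma inconsistency_eq_inf' (hW : ∀ i, 0 < W i) (hq : q ≤ m) (y : Fin m → ℝ) (x : State n) :
    inconsistency H W q y x = (Finset.powersetCard q (Finset.univ : Finset (Fin m))).inf'
      (powersetCard_nonempty hq) fun C => residualOff H W C y x := by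
  refine le_antisymm ?_ ?_
  · exact Finset.le_inf' _ _ fun C hC =>
      inconsistency_le_residualOff hW (Finset.mem_powersetCard.1 hC).2.le y x
  · have : Nonempty {a : Fin m → ℝ // hammingNorm a ≤ q} := ⟨⟨0, by simp⟩⟩
    refine le_ciInf fun a => ?_
    obtain ⟨C, hC, hle⟩ := exists_residualOff_le hW hq y x a.2
    exact (Finset.inf'_le _ (Finset.mem_powersetCard.2 ⟨Finset.subset_univ _, hC⟩)).trans hle

lemma exists_inconsistency_eq (hW : ∀ i, 0 < W i) (hq : q ≤ m) (y : Fin m → ℝ) (x : State n) :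
    ∃ C : Finset (Fin m), C.card = q ∧ inconsistency H W q y x = residualOff H W C y x := by
  obtain ⟨C, hC, h⟩ := Finset.exists_mem_eq_inf' (powersetCard_nonempty (m := m) hq)
    fun C => residualOff H W C y x
  exact ⟨C, (Finset.mem_powersetCard.1 hC).2, (inconsistency_eq_inf' hW hq y x).trans h⟩

lemma inconsistency_nonneg (hW : ∀ i, 0 < W i) (hq : q ≤ m) (y : Fin m → ℝ) (x : State n) :
    0 ≤ inconsistency H W q y x := by
  obtain ⟨C, -, h⟩ := exists_inconsistency_eq (H := H) hW hq y x
  exact h ▸ residualOff_nonneg hW C y x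

lemma continuous_inconsistency (hW : ∀ i, 0 < W i) (hq : q ≤ m) (y : Fin m → ℝ) :
    Continuous (inconsistency H W q y) := by
  have : inconsistency H W q y = (Finset.powersetCard q (Finset.univ : Finset (Fin m))).inf'
      (powersetCard_nonempty hq) fun C => residualOff H W C y := by
    ext x
    rw [inconsistency_eq_inf' hW hq, Finset.inf'_apply]
  rw [this]
  refine Continuous.finset_inf' _ fun C _ => ?_
  unfold residualOff
  simp only [Matrix.mulVec, dotProduct]
  fun_prop

lemma lt_of_sparseObservable (hn : 0 < n) (hobs : SparseObservable H (2 * q)) : 2 * q < m := by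
  by_contra hm
  have := hobs ∅ (by simp; omega)
  have hle := (rows H ∅).rank_le_card_height
  simp at hle
  omega

lemma eq_zero_of_sparseObservable (hobs : SparseObservable H (2 * q)) {C : Finset (Fin m)}
    (hC : C.card ≤ 2 * q) {v : Fin n → ℝ} (hv : ∀ i ∈ Cᶜ, (H *ᵥ v) i = 0) : v = 0 := by
  obtain ⟨I, hI, hcard⟩ := Finset.exists_subset_card_eq (s := Cᶜ) (n := m - 2 * q)
    (by rw [Finset.card_compl, Fintype.card_fin]; omega)
  have hrank := hobs I hcard
  have hker : LinearMap.ker (rows H I).mulVecLin = ⊥ := by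
    have := LinearMap.finrank_range_add_finrank_ker (rows H I).mulVecLin
    rw [Matrix.rank] at hrank
    rw [hrank, Module.finrank_fin_fun] at this
    exact Submodule.finrank_eq_zero.1 (by omega)
  have : v ∈ LinearMap.ker (rows H I).mulVecLin := by
    rw [LinearMap.mem_ker]
    ext i
    exact hv i (hI i.2)
  simpa [hker] using this

/-- The rows outside `C` define an injective linear map by observability. In finite dimension such a
map is antilipschitz, so preimages of bounded sets are bounded, and a bounded residual confines each
image coordinate to an interval around `y i`. -/
lemma isBounded_residualOff_le (hW : ∀ i, 0 < W i) (hobs : SparseObservable H (2 * q))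
    {C : Finset (Fin m)} (hC : C.card ≤ 2 * q) (y : Fin m → ℝ) (φ : ℝ) :
    Bornology.IsBounded {x : State n | residualOff H W C y x ≤ φ} := by
  let f : State n →ₗ[ℝ] ((Cᶜ : Finset (Fin m)) → ℝ) :=
    (rows H Cᶜ).mulVecLin ∘ₗ (WithLp.linearEquiv 2 ℝ (Fin n → ℝ)).toLinearMap
  have hf : LinearMap.ker f = ⊥ := by
    refine (Submodule.eq_bot_iff _).2 fun x hx => ?_
    have h0 : x.ofLp = 0 := eq_zero_of_sparseObservable hobs hC fun i hi =>
      congrFun (LinearMap.mem_ker.1 hx) ⟨i, hi⟩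
    ext i
    simp [h0]
  obtain ⟨K, -, hK⟩ := f.exists_antilipschitzWith hf
  have hb : Bornology.IsBounded {v : (Cᶜ : Finset (Fin m)) → ℝ |
      ∀ i : (Cᶜ : Finset (Fin m)), v i ∈ Metric.closedBall (y i) (Real.sqrt (2 * φ * W i))} := by
    have := Bornology.IsBounded.pi fun i : (Cᶜ : Finset (Fin m)) =>
      Metric.isBounded_closedBall (x := y i) (r := Real.sqrt (2 * φ * W i))
    refine this.subset fun v hv i _ => hv i
  refine (hK.isBounded_preimage hb).subset fun x hx (i : (Cᶜ : Finset (Fin m))) => ?_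
  have hi : (y i - (H *ᵥ x.ofLp) i) ^ 2 / W i ≤ 2 * φ := by
    have h₁ := Finset.single_le_sum (f := fun i => (y i - (H *ᵥ x.ofLp) i) ^ 2 / W i)
      (fun i _ => div_nonneg (sq_nonneg _) (hW i).le) i.2
    have h₂ : residualOff H W C y x ≤ φ := hx
    unfold residualOff at h₂
    linarith
  rw [div_le_iff₀ (hW i)] at hi
  rw [Metric.mem_closedBall, dist_comm, Real.dist_eq]
  exact Real.abs_le_sqrt hi

lemma isBounded_levelSet (hW : ∀ i, 0 < W i) (hn : 0 < n) (hobs : SparseObservable H (2 * q))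
    (y : Fin m → ℝ) (φ : ℝ) : Bornology.IsBounded (levelSet H W q y φ) := by
  have hq : q ≤ m := by have := lt_of_sparseObservable hn hobs; omega
  have := (Bornology.isBounded_biUnion_finset
    (Finset.powersetCard q (Finset.univ : Finset (Fin m)))
    (f := fun C => {x : State n | residualOff H W C y x ≤ φ})).2 fun C hC =>
      isBounded_residualOff_le hW hobs
        (by rw [(Finset.mem_powersetCard.1 hC).2]; omega) y φ
  refine this.subset fun x hx => ?_
  obtain ⟨C, hC, h⟩ := exists_inconsistency_eq (H := H) hW hq y x
  refine Set.mem_iUnion₂.2 ⟨C, Finset.mem_powersetCard.2 ⟨Finset.subset_univ _, hC⟩, ?_⟩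
  exact h.symm.le.trans hx

lemma isCompact_levelSet (hW : ∀ i, 0 < W i) (hn : 0 < n) (hobs : SparseObservable H (2 * q))
    (y : Fin m → ℝ) (φ : ℝ) : IsCompact (levelSet H W q y φ) := by
  have hq : q ≤ m := by have := lt_of_sparseObservable hn hobs; omega
  exact Metric.isCompact_of_isClosed_isBounded
    (isClosed_le (continuous_inconsistency hW hq y) continuous_const)
    (isBounded_levelSet hW hn hobs y φ)

lemma levelSet_mono (y : Fin m → ℝ) {φ ψ : ℝ} (h : φ ≤ ψ) :
    levelSet H W q y φ ⊆ levelSet H W q y ψ :=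
  fun _ hx => le_trans hx h

lemma lt_of_rad_levelSet_lt {y : Fin m → ℝ} {φ ψ : ℝ}
    (h : rad (levelSet H W q y φ) < rad (levelSet H W q y ψ)) : φ < ψ := by
  by_contra hle
  exact absurd h (not_lt.2 (rad_mono (levelSet_mono y (not_lt.1 hle))))

/-- Compactness leaves room: some closed thickening of the lower level set stays inside the open set
where the inconsistency is below `ψ`. -/
lemma rad_levelSet_lt (hW : ∀ i, 0 < W i) (hn : 0 < n) (hobs : SparseObservable H (2 * q))
    {y : Fin m → ℝ} {φ ψ : ℝ} (h : φ < ψ) (hne : (levelSet H W q y φ).Nonempty) :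
    rad (levelSet H W q y φ) < rad (levelSet H W q y ψ) := by
  have hq : q ≤ m := by have := lt_of_sparseObservable hn hobs; omega
  obtain ⟨η, hη, hsub⟩ := (isCompact_levelSet hW hn hobs y φ).exists_cthickening_subset_open
    (isOpen_lt (continuous_inconsistency (H := H) (W := W) hW hq y) continuous_const)
    (fun x (hx : inconsistency H W q y x ≤ φ) => hx.trans_lt h)
  exact rad_lt_rad_of_cthickening_subset hn hη (isBounded_levelSet hW hn hobs y φ) hne
    (hsub.trans fun x (hx : inconsistency H W q y x < ψ) => le_of_lt hx)

lemma exists_isInitialUpper (hn : 0 < n) {δ : ℝ} (hδ : 0 < δ) (y : Fin m → ℝ) :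
    ∃ φ : ℝ, IsInitialUpper (n := n) H W q δ y φ := by
  -- A level high enough to contain both `v` and `-v` has radius at least `‖v‖ = 2δ > δ`.
  let v : State n := EuclideanSpace.single ⟨0, hn⟩ (2 * δ)
  have hv : ‖v‖ = 2 * δ := by simp [v, abs_of_pos hδ]
  refine ⟨max (inconsistency H W q y v) (inconsistency H W q y (-v)), ?_⟩
  refine lt_of_lt_of_le ?_ (le_rad_of_mem_of_neg_mem (v := v)
    (show inconsistency H W q y v ≤ _ from le_max_left _ _)
    (show inconsistency H W q y (-v) ≤ _ from le_max_right _ _))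
  rw [hv, ENNReal.ofReal_lt_ofReal_iff (by linarith)]
  linarith

/-! ### The smallest residue -/

lemma inv_cov (hW : ∀ i, 0 < W i) (I : Finset (Fin m)) :
    (cov W I)⁻¹ = Matrix.diagonal fun i : I => (W i)⁻¹ := by
  refine Matrix.inv_eq_left_inv ?_
  rw [cov, Matrix.diagonal_mul_diagonal, ← Matrix.diagonal_one]
  congr 1
  ext i
  exact inv_mul_cancel₀ (hW i).ne'

lemma dotProduct_inv_cov_mulVec (hW : ∀ i, 0 < W i) (I : Finset (Fin m)) (e : I → ℝ) :
    e ⬝ᵥ ((cov W I)⁻¹ *ᵥ e) = ∑ i, e i ^ 2 / W i := by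
  rw [inv_cov hW]
  simp only [dotProduct, Matrix.mulVec_diagonal]
  refine Finset.sum_congr rfl fun i _ => ?_
  rw [div_eq_mul_inv]
  ring

lemma residualOff_compl_eq (hW : ∀ i, 0 < W i) (I : Finset (Fin m)) (y : Fin m → ℝ)
    (x : State n) : residualOff H W Iᶜ y x =
      (1 / 2) * (((fun i : I => y i) - rows H I *ᵥ x.ofLp) ⬝ᵥ
        ((cov W I)⁻¹ *ᵥ ((fun i : I => y i) - rows H I *ᵥ x.ofLp))) := by
  rw [dotProduct_inv_cov_mulVec hW, residualOff, compl_compl, ← Finset.sum_coe_sort I]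
  rfl

lemma residue_eq_residualOff (hW : ∀ i, 0 < W i) (I : Finset (Fin m)) (y : Fin m → ℝ) :
    residue H W y I = residualOff H W Iᶜ y
      (WithLp.toLp 2 (lsMatrix H W I *ᵥ fun i : I => y i)) := by
  rw [residualOff_compl_eq hW]
  rfl

/-- These are the normal equations. Observability makes the weighted Gram matrix positive definite,
so the inverse in `lsMatrix` is a true inverse. -/
lemma rows_transpose_mulVec_lsError (hW : ∀ i, 0 < W i) (hobs : SparseObservable H (2 * q))
    {I : Finset (Fin m)} (hI : m - 2 * q ≤ I.card) (y : Fin m → ℝ) :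
    (rows H I)ᵀ *ᵥ ((cov W I)⁻¹ *ᵥ lsError H W y I) = 0 := by
  have hinj : Function.Injective (rows H I).mulVec := by
    rw [← Matrix.coe_mulVecLin, ← LinearMap.ker_eq_bot]
    refine (Submodule.eq_bot_iff _).2 fun v hv => ?_
    refine eq_zero_of_sparseObservable hobs (C := Iᶜ) ?_ fun i hi => ?_
    · rw [Finset.card_compl, Fintype.card_fin]; omega
    · rw [compl_compl] at hi
      exact congrFun (LinearMap.mem_ker.1 hv) ⟨i, hi⟩
  have hpos : ((cov W I)⁻¹).PosDef := by
    rw [inv_cov hW]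
    exact Matrix.PosDef.diagonal fun i => inv_pos.2 (hW i)
  have hunit : IsUnit ((rows H I)ᵀ * (cov W I)⁻¹ * rows H I) := by
    have := (hpos.conjTranspose_mul_mul_same hinj).isUnit
    rwa [Matrix.conjTranspose_eq_transpose_of_trivial] at this
  rw [lsError, lsMatrix, Matrix.mulVec_sub, Matrix.mulVec_sub, sub_eq_zero]
  simp only [Matrix.mulVec_mulVec]
  congr 1
  simp only [← Matrix.mul_assoc]
  rw [Matrix.mul_nonsing_inv _ ((Matrix.isUnit_iff_isUnit_det _).1 hunit), Matrix.one_mul]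

/-- Pythagoras in the weighted inner product: the least squares error is orthogonal to the range of
`rows H I`, so any other state only adds a nonnegative square. -/
lemma residue_le_residualOff (hW : ∀ i, 0 < W i) (hobs : SparseObservable H (2 * q))
    {I : Finset (Fin m)} (hI : m - 2 * q ≤ I.card) (y : Fin m → ℝ) (x : State n) :
    residue H W y I ≤ residualOff H W Iᶜ y x := by
  have h0 := rows_transpose_mulVec_lsError hW hobs hI y
  rw [residualOff_compl_eq hW, residue]
  set D := (cov W I)⁻¹ with hD
  set e := lsError H W y I with he
  set d := lsMatrix H W I *ᵥ (fun i : I => y i) - x.ofLp with hd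
  have hsum : (fun i : I => y i) - rows H I *ᵥ x.ofLp = e + rows H I *ᵥ d := by
    rw [he, lsError, hd, Matrix.mulVec_sub]
    abel
  have hcross : (rows H I *ᵥ d) ⬝ᵥ (D *ᵥ e) = 0 := by
    rw [dotProduct_comm, Matrix.dotProduct_mulVec, ← Matrix.mulVec_transpose, h0, zero_dotProduct]
  have hsymm : e ⬝ᵥ (D *ᵥ (rows H I *ᵥ d)) = (rows H I *ᵥ d) ⬝ᵥ (D *ᵥ e) := by
    rw [hD, inv_cov hW]
    simp only [dotProduct, Matrix.mulVec_diagonal]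
    exact Finset.sum_congr rfl fun i _ => by ring
  have hnn : 0 ≤ (rows H I *ᵥ d) ⬝ᵥ (D *ᵥ (rows H I *ᵥ d)) := by
    rw [hD, dotProduct_inv_cov_mulVec hW]
    exact Finset.sum_nonneg fun i _ => div_nonneg (sq_nonneg _) (hW i).le
  rw [hsum, Matrix.mulVec_add, add_dotProduct, dotProduct_add, dotProduct_add, hsymm, hcross]
  linarith

lemma minResidue_le_inconsistency (hW : ∀ i, 0 < W i) (hn : 0 < n)
    (hobs : SparseObservable H (2 * q)) (y : Fin m → ℝ) (x : State n) :
    minResidue H W q y ≤ inconsistency H W q y x := by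
  have hm := lt_of_sparseObservable hn hobs
  obtain ⟨C, hC, h⟩ := exists_inconsistency_eq (H := H) (q := q) hW (by omega) y x
  have hcard : (Cᶜ : Finset (Fin m)).card = m - q := by
    rw [Finset.card_compl, Fintype.card_fin, hC]
  rw [h]
  refine (ciInf_le (Set.finite_range _).bddBelow ⟨Cᶜ, hcard⟩).trans ?_
  have := residue_le_residualOff hW hobs (I := Cᶜ) (by omega) y x
  rwa [compl_compl] at this

/-- The least squares solution for a minimizing index set lies in this level. With
`minResidue_le_inconsistency`, `Υ` is therefore the smallest inconsistency, and the maximum with `Υ`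
in the final step keeps the returned center that of a nonempty set. -/
lemma levelSet_minResidue_nonempty (hW : ∀ i, 0 < W i) (hn : 0 < n)
    (hobs : SparseObservable H (2 * q)) (y : Fin m → ℝ) :
    (levelSet H W q y (minResidue H W q y)).Nonempty := by
  have hm := lt_of_sparseObservable hn hobs
  have : Nonempty {I : Finset (Fin m) // I.card = m - q} := by
    obtain ⟨I, -, hI⟩ := Finset.exists_subset_card_eq (s := (Finset.univ : Finset (Fin m)))
      (n := m - q) (by simp)
    exact ⟨⟨I, hI⟩⟩
  obtain ⟨⟨I, hI⟩, h⟩ := exists_eq_ciInf_of_finite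
    (f := fun I : {I : Finset (Fin m) // I.card = m - q} => residue H W y I.1)
  refine ⟨WithLp.toLp 2 (lsMatrix H W I *ᵥ fun i : I => y i), ?_⟩
  have hle := inconsistency_le_residualOff (H := H) (q := q) (C := Iᶜ) hW
    (by rw [Finset.card_compl, Fintype.card_fin]; omega) y
    (WithLp.toLp 2 (lsMatrix H W I *ᵥ fun i : I => y i))
  rw [← residue_eq_residualOff hW] at hle
  exact hle.trans h.le

lemma levelSet_nonempty (hW : ∀ i, 0 < W i) (hn : 0 < n)
    (hobs : SparseObservable H (2 * q)) {y : Fin m → ℝ} {φ : ℝ} (h : minResidue H W q y ≤ φ) :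
    (levelSet H W q y φ).Nonempty :=
  (levelSet_minResidue_nonempty hW hn hobs y).mono (levelSet_mono y h)

end LevelSets

/-! ### The bisection algorithm -/

section Bisection

variable {m n q : ℕ} {H : Matrix (Fin m) (Fin n) ℝ} {W : Fin m → ℝ}

lemma isBounded_maxLevelSet (hW : ∀ i, 0 < W i) (hn : 0 < n) (hobs : SparseObservable H (2 * q))
    {δ : ℝ} (hδ : 0 < δ) (y : Fin m → ℝ) : Bornology.IsBounded (maxLevelSet H W q y δ) := by
  obtain ⟨ψ, hψ⟩ := exists_isInitialUpper (H := H) (W := W) (q := q) hn hδ y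
  refine (isBounded_levelSet hW hn hobs y ψ).subset ?_
  rintro x ⟨φ, -, hrad, hx⟩
  exact levelSet_mono y (lt_of_rad_levelSet_lt (hrad.trans_lt hψ)).le hx

/-- Each round halves the gap, so `N` bounds the number of rounds before the tolerance test
succeeds. -/
lemma exists_bisectionOutput (hW : ∀ i, 0 < W i) (hn : 0 < n)
    (hobs : SparseObservable H (2 * q)) {δ ε : ℝ} (hδ : 0 < δ) (y : Fin m → ℝ)
    (N : ℕ) {lo hi : ℝ} (hgap : hi - lo < ε / 2 * 2 ^ N) :
    ∃ x, BisectionOutput H W q δ ε y lo hi x := by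
  induction N generalizing lo hi with
  | zero =>
    obtain ⟨x, hx⟩ := exists_isChebyshevCenter (isBounded_levelSet hW hn hobs y _)
      (levelSet_nonempty hW hn hobs (le_max_left (minResidue H W q y) (lo - ε / 2)))
    exact ⟨x, .tolerance (by simpa using hgap) hx⟩
  | succ N ih =>
    rw [pow_succ] at hgap
    by_cases h : hi - lo < ε / 2
    · obtain ⟨x, hx⟩ := exists_isChebyshevCenter (isBounded_levelSet hW hn hobs y _)
        (levelSet_nonempty hW hn hobs (le_max_left (minResidue H W q y) (lo - ε / 2)))
      exact ⟨x, .tolerance h hx⟩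
    rcases lt_trichotomy (rad (levelSet H W q y ((lo + hi) / 2))) (ENNReal.ofReal δ) with hr | hr | hr
    · obtain ⟨x, hx⟩ := ih (lo := (lo + hi) / 2) (hi := hi) (by linarith)
      exact ⟨x, .increaseLower h hr hx⟩
    · obtain ⟨x, hx⟩ := exists_isChebyshevCenter
        (isBounded_levelSet hW hn hobs y ((lo + hi) / 2))
        (nonempty_of_rad_pos (by rw [hr]; exact ENNReal.ofReal_pos.2 hδ))
      exact ⟨x, .exact h hr hx⟩
    · obtain ⟨x, hx⟩ := ih (lo := lo) (hi := (lo + hi) / 2) (by linarith)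
      exact ⟨x, .decreaseUpper h hr hx⟩

lemma BisectionOutput.unique (hW : ∀ i, 0 < W i) (hn : 0 < n)
    (hobs : SparseObservable H (2 * q)) {δ ε : ℝ} (hδ : 0 < δ) {y : Fin m → ℝ} {lo hi : ℝ}
    {x x' : State n} (h : BisectionOutput H W q δ ε y lo hi x)
    (h' : BisectionOutput H W q δ ε y lo hi x') : x = x' := by
  induction h with
  | tolerance hgap hx =>
    cases h' with
    | tolerance _ hx' =>
      exact IsChebyshevCenter.unique (isBounded_levelSet hW hn hobs y _)
        (levelSet_nonempty hW hn hobs (le_max_left _ _)) hx hx'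
    | exact hgap' => exact absurd hgap hgap'
    | decreaseUpper hgap' => exact absurd hgap hgap'
    | increaseLower hgap' => exact absurd hgap hgap'
  | exact hgap hr hx =>
    cases h' with
    | tolerance hgap' => exact absurd hgap' hgap
    | exact _ _ hx' =>
      exact IsChebyshevCenter.unique (isBounded_levelSet hW hn hobs y _)
        (nonempty_of_rad_pos (by rw [hr]; exact ENNReal.ofReal_pos.2 hδ)) hx hx'
    | decreaseUpper _ hr' => exact absurd hr' (by rw [hr]; exact lt_irrefl _)
    | increaseLower _ hr' => exact absurd hr' (by rw [hr]; exact lt_irrefl _)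
  | decreaseUpper hgap hr _ ih =>
    cases h' with
    | tolerance hgap' => exact absurd hgap' hgap
    | exact _ hr' => exact absurd hr (by rw [hr']; exact lt_irrefl _)
    | decreaseUpper _ _ hnext => exact ih hnext
    | increaseLower _ hr' => exact absurd hr hr'.not_gt
  | increaseLower hgap hr _ ih =>
    cases h' with
    | tolerance hgap' => exact absurd hgap' hgap
    | exact _ hr' => exact absurd hr (by rw [hr']; exact lt_irrefl _)
    | decreaseUpper _ hr' => exact absurd hr hr'.not_gt
    | increaseLower _ _ hnext => exact ih hnext

lemma existsUnique_algorithmOutput (hW : ∀ i, 0 < W i) (hn : 0 < n)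
    (hobs : SparseObservable H (2 * q)) {δ ε : ℝ} (hδ : 0 < δ) (hε : 0 < ε) (y : Fin m → ℝ)
    (φ : ℝ) : ∃! x : State n, AlgorithmOutput H W q δ ε y φ x := by
  obtain ⟨N, hN⟩ := pow_unbounded_of_one_lt ((φ - minResidue H W q y) / (ε / 2)) one_lt_two
  rw [div_lt_iff₀ (by linarith), mul_comm] at hN
  obtain ⟨x, hx⟩ := exists_bisectionOutput hW hn hobs hδ y N hN
  exact ⟨x, hx, fun x' hx' => BisectionOutput.unique hW hn hobs hδ hx' hx⟩

/-- If `R` is at most every `φ` with `rad 𝒳(y, φ) > δ`, then every state that is `δ`-far from the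
output of the bisection has inconsistency at least `R - ε`. -/
lemma BisectionOutput.le_inconsistency_add (hW : ∀ i, 0 < W i) (hn : 0 < n)
    (hobs : SparseObservable H (2 * q)) {δ ε : ℝ} (hδ : 0 < δ) (hε : 0 < ε) {y : Fin m → ℝ}
    {R : EReal} (hR : ∀ φ : ℝ, IsInitialUpper (n := n) H W q δ y φ → R ≤ (φ : EReal))
    {lo hi : ℝ} {x : State n} (h : BisectionOutput H W q δ ε y lo hi x)
    (hhi : IsInitialUpper (n := n) H W q δ y hi) (hlo : minResidue H W q y ≤ lo)
    (hlo' : lo = minResidue H W q y ∨ rad (levelSet H W q y lo) ≤ ENNReal.ofReal δ)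
    {x' : State n} (hx' : δ < ‖x - x'‖) :
    R ≤ ((inconsistency H W q y x' + ε : ℝ) : EReal) := by
  -- The hypotheses on `hi` and `lo` are the loop invariants. The alternative in `hlo'` covers the
  -- initial `lo = Υ`, where the radius may already exceed `δ`.
  induction h with
  | @tolerance lo hi x hgap hx =>
    refine (hR hi hhi).trans (EReal.coe_le_coe_iff.2 ?_)
    -- If `lo` never moved, every state has inconsistency at least `lo > hi - ε/2`. Otherwise the
    -- returned center covers its level set within `δ`, so a far state has inconsistency above `lo -
    -- ε/2 > hi - ε`.
    rcases hlo' with rfl | hrad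
    · have := minResidue_le_inconsistency hW hn hobs y x'
      linarith
    · have hsub := levelSet_mono (H := H) (W := W) (q := q) y
        (max_le hlo (by linarith : lo - ε / 2 ≤ lo))
      have hnot : x' ∉ levelSet H W q y (max (minResidue H W q y) (lo - ε / 2)) := fun hmem =>
        absurd hx' (not_lt.2 (hx.norm_sub_le hδ.le ((rad_mono hsub).trans hrad) hmem))
      have h₀ : max (minResidue H W q y) (lo - ε / 2) < inconsistency H W q y x' := not_le.1 hnot
      have h₁ := (le_max_right _ _).trans_lt h₀
      linarith
  | @exact lo hi x hgap hrad hx =>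
    have hnot : x' ∉ levelSet H W q y ((lo + hi) / 2) := fun hmem =>
      absurd hx' (not_lt.2 (hx.norm_sub_le hδ.le hrad.le hmem))
    have h₁ : (lo + hi) / 2 < inconsistency H W q y x' := not_le.1 hnot
    have hne := nonempty_of_rad_pos (A := levelSet H W q y ((lo + hi) / 2))
      (by rw [hrad]; exact ENNReal.ofReal_pos.2 hδ)
    -- Strict growth of the radius past the exact level shows that adding `ε` to the inconsistency
    -- of `x'` gives a level of radius larger than `δ`.
    refine hR _ ?_
    rw [IsInitialUpper, ← hrad]
    exact rad_levelSet_lt hW hn hobs (by linarith) hne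
  | decreaseUpper hgap hrad _ ih => exact ih hrad hlo hlo' hx'
  | @increaseLower lo hi x hgap hrad _ ih =>
    exact ih hhi (by linarith) (.inr hrad.le) hx'

end Bisection

/-! ### Product measures -/

lemma lintegral_pi_prod {ι : Type*} [Fintype ι] {X : ι → Type*} [∀ i, MeasurableSpace (X i)]
    (μ : ∀ i, Measure (X i)) [∀ i, IsProbabilityMeasure (μ i)] {f : ∀ i, X i → ℝ≥0∞}
    (hf : ∀ i, Measurable (f i)) :
    ∫⁻ x, ∏ i, f i (x i) ∂Measure.pi μ = ∏ i, ∫⁻ z, f i z ∂μ i := by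
  refine (lintegral_prod_eq_prod_lintegral_of_indepFun Finset.univ
    (fun i (x : ∀ i, X i) => f i (x i))
    (iIndepFun_pi fun i => (hf i).aemeasurable) fun i => (hf i).comp (measurable_pi_apply i)).trans ?_
  refine Finset.prod_congr rfl fun i _ => ?_
  rw [← (measurePreserving_eval μ i).lintegral_comp (hf i)]

lemma pi_withDensity {ι : Type*} [Fintype ι] {X : ι → Type*} [∀ i, MeasurableSpace (X i)]
    (μ : ∀ i, Measure (X i)) [∀ i, IsProbabilityMeasure (μ i)] {f : ∀ i, X i → ℝ≥0∞}
    (hf : ∀ i, Measurable (f i)) [∀ i, SigmaFinite ((μ i).withDensity (f i))] :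
    Measure.pi (fun i => (μ i).withDensity (f i)) =
      (Measure.pi μ).withDensity fun x => ∏ i, f i (x i) := by
  refine Measure.pi_eq fun s hs => ?_
  rw [withDensity_apply _ (MeasurableSet.univ_pi hs),
    ← lintegral_indicator (MeasurableSet.univ_pi hs)]
  have : (Set.univ.pi s).indicator (fun x => ∏ i, f i (x i)) =
      fun x => ∏ i, (s i).indicator (f i) (x i) := by
    ext x
    by_cases hx : x ∈ Set.univ.pi s
    · rw [Set.indicator_of_mem hx]
      exact Finset.prod_congr rfl fun i _ => (Set.indicator_of_mem (hx i trivial) _).symm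
    · rw [Set.indicator_of_notMem hx]
      simp only [Set.mem_pi, Set.mem_univ, true_imp_iff, not_forall] at hx
      obtain ⟨i, hi⟩ := hx
      exact (Finset.prod_eq_zero (Finset.mem_univ i) (Set.indicator_of_notMem hi _)).symm
  rw [this, lintegral_pi_prod μ fun i => (hf i).indicator (hs i)]
  exact Finset.prod_congr rfl fun i _ => by
    rw [lintegral_indicator (hs i), withDensity_apply _ (hs i)]

lemma pi_prod_pi_map_add {ι : Type*} [Fintype ι] (μ ν : ι → Measure ℝ)
    [∀ i, IsProbabilityMeasure (μ i)] [∀ i, IsProbabilityMeasure (ν i)] :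
    ((Measure.pi μ).prod (Measure.pi ν)).map (fun p => p.1 + p.2) =
      Measure.pi fun i => μ i ∗ ν i := by
  rw [← (measurePreserving_arrowProdEquivProdArrow ℝ ℝ ι μ ν).map_eq,
    Measure.map_map (by fun_prop) (MeasurableEquiv.measurable _)]
  simp only [Measure.conv]
  rw [← Measure.pi_map_pi (f := fun _ (p : ℝ × ℝ) => p.1 + p.2) fun i => by fun_prop]
  rfl

lemma measurable_snoc {α : Type*} [MeasurableSpace α] (k : ℕ) :
    Measurable fun p : (Fin k → α) × α => (Fin.snoc p.1 p.2 : Fin (k + 1) → α) := by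
  refine measurable_pi_lambda _ fun j => ?_
  refine Fin.lastCases ?_ (fun j => ?_) j
  · simp only [Fin.snoc_last]; fun_prop
  · simp only [Fin.snoc_castSucc]; fun_prop

lemma pi_prod_map_snoc {α : Type*} [MeasurableSpace α] (μ : Measure α) [IsProbabilityMeasure μ]
    (k : ℕ) : ((Measure.pi fun _ : Fin k => μ).prod μ).map
      (fun p => (Fin.snoc p.1 p.2 : Fin (k + 1) → α)) = Measure.pi fun _ : Fin (k + 1) => μ := by
  refine (Measure.pi_eq fun s hs => ?_).symm
  rw [Measure.map_apply (measurable_snoc k) (MeasurableSet.univ_pi hs)]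
  have : (fun p : (Fin k → α) × α => (Fin.snoc p.1 p.2 : Fin (k + 1) → α)) ⁻¹' Set.univ.pi s =
      (Set.univ.pi fun j : Fin k => s j.castSucc) ×ˢ s (Fin.last k) := by
    ext p
    simp [Set.mem_pi, Fin.forall_fin_succ']
  rw [this, Measure.prod_prod, Measure.pi_pi, Fin.prod_univ_castSucc]

/-! ### Gaussian vectors and their averages -/

/-- The law of a vector with independent entries `N(cᵢ, Wᵢ)`. -/
def gaussianPi {m : ℕ} (c : Fin m → ℝ) (W : Fin m → ℝ) : Measure (Fin m → ℝ) :=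
  Measure.pi fun i => gaussianReal (c i) (W i).toNNReal

instance {m : ℕ} (c : Fin m → ℝ) (W : Fin m → ℝ) : IsProbabilityMeasure (gaussianPi c W) := by
  unfold gaussianPi; infer_instance

/-- The law of `k` independent vectors with law `gaussianPi c W`. -/
def gaussianRecord {m : ℕ} (c : Fin m → ℝ) (W : Fin m → ℝ) (k : ℕ) : Measure (Record m k) :=
  Measure.pi fun _ => gaussianPi c W

instance {m : ℕ} (c : Fin m → ℝ) (W : Fin m → ℝ) (k : ℕ) :
    IsProbabilityMeasure (gaussianRecord c W k) := by
  unfold gaussianRecord; infer_instance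

lemma gaussianPi_map_add_const {m : ℕ} (c W a : Fin m → ℝ) :
    (gaussianPi c W).map (fun z => z + a) = gaussianPi (c + a) W := by
  have := Measure.pi_map_pi (μ := fun i => gaussianReal (c i) (W i).toNNReal)
    (f := fun i (z : ℝ) => z + a i) fun i => by fun_prop
  simp only [gaussianReal_map_add_const] at this
  exact this

lemma gaussianRecord_map_add_const {m : ℕ} (c W a : Fin m → ℝ) (k : ℕ) :
    (gaussianRecord c W k).map (fun Y => Y + fun _ => a) = gaussianRecord (c + a) W k := by
  have h := gaussianPi_map_add_const c W a
  have : IsProbabilityMeasure ((gaussianPi c W).map fun z => z + a) := by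
    rw [h]; infer_instance
  have := Measure.pi_map_pi (μ := fun _ : Fin k => gaussianPi c W)
    (f := fun _ z => z + a) fun i => by fun_prop
  rw [h] at this
  exact this

/-- Induction by convolution of Gaussians. The start `k = 0` fits because a Gaussian of variance `0`
is a Dirac mass. -/
lemma gaussianRecord_map_sum {m : ℕ} (c : Fin m → ℝ) {W : Fin m → ℝ} (hW : ∀ i, 0 < W i) (k : ℕ) :
    (gaussianRecord c W k).map (fun Y => ∑ j, Y j) =
      gaussianPi (fun i => k * c i) (fun i => k * W i) := by
  induction k with
  | zero =>
    have h0 : Measure.map (fun Y : Record m 0 => ∑ j, Y j) (gaussianRecord c W 0) =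
        Measure.dirac 0 := by
      simp [Measure.map_const]
    rw [h0]
    simp only [gaussianPi, CharP.cast_eq_zero, zero_mul, Real.toNNReal_zero, gaussianReal_zero_var]
    refine (Measure.pi_eq fun s hs => ?_).symm
    classical
    rw [Measure.dirac_apply' _ (MeasurableSet.univ_pi hs)]
    simp only [fun i => Measure.dirac_apply' (0 : ℝ) (hs i), Set.indicator_apply, Set.mem_pi,
      Set.mem_univ, true_imp_iff, Pi.zero_apply, Pi.one_apply]
    by_cases h : ∀ i, (0 : ℝ) ∈ s i
    · simp [h]
    · rw [if_neg h]
      push Not at h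
      obtain ⟨i, hi⟩ := h
      exact (Finset.prod_eq_zero (Finset.mem_univ i) (by simp [hi])).symm
  | succ k ih =>
    rw [gaussianRecord, ← pi_prod_map_snoc, Measure.map_map (by fun_prop) (measurable_snoc k)]
    have hcomp : (fun Y : Record m (k + 1) => ∑ j, Y j) ∘
        (fun p : Record m k × (Fin m → ℝ) => (Fin.snoc p.1 p.2 : Record m (k + 1))) =
        (fun p => p.1 + p.2) ∘ Prod.map (fun Y : Record m k => ∑ j, Y j) id := by
      ext p
      simp [Fin.sum_univ_castSucc]
    rw [hcomp, ← Measure.map_map (by fun_prop) (by fun_prop), ← Measure.map_prod_map _ _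
      (by fun_prop) measurable_id, Measure.map_id]
    change Measure.map _ ((Measure.map _ (gaussianRecord c W k)).prod _) = _
    rw [ih, gaussianPi, gaussianPi, pi_prod_pi_map_add]
    simp only [gaussianReal_conv_gaussianReal, gaussianPi]
    congr 1
    ext1 i
    rw [← Real.toNNReal_add (by have := hW i; positivity) (hW i).le]
    congr 1
    · push_cast; ring
    · push_cast; ring_nf

/-- The exponential moment `𝔼 exp(θ Z² / 2)` of a standard Gaussian variable. -/
def gaussianSqMoment (θ : ℝ) : ℝ≥0∞ :=
  ∫⁻ t, ENNReal.ofReal (Real.exp (θ * t ^ 2 / 2)) ∂gaussianReal 0 1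

lemma gaussianSqMoment_lt_top {θ : ℝ} (hθ : θ < 1) : gaussianSqMoment θ < ∞ := by
  rw [gaussianSqMoment, gaussianReal_of_var_ne_zero _ one_ne_zero,
    lintegral_withDensity_eq_lintegral_mul _ (measurable_gaussianPDF 0 1) (by fun_prop)]
  have hint : Integrable (fun t : ℝ =>
      (√(2 * Real.pi))⁻¹ * Real.exp (-((1 - θ) / 2) * t ^ 2)) :=
    (integrable_exp_neg_mul_sq (by linarith)).const_mul _
  refine lt_of_le_of_lt (le_of_eq ?_) hint.lintegral_lt_top
  refine lintegral_congr fun t => ?_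
  simp only [Pi.mul_apply, gaussianPDF, gaussianPDFReal]
  rw [← ENNReal.ofReal_mul (by positivity), mul_assoc, ← Real.exp_add]
  simp only [NNReal.coe_one, mul_one, sub_zero]
  congr 3
  ring

lemma lintegral_exp_sq_gaussianReal (θ c : ℝ) {v : ℝ} (hv : 0 < v) :
    ∫⁻ s, ENNReal.ofReal (Real.exp (θ * (s - c) ^ 2 / (2 * v))) ∂gaussianReal c v.toNNReal =
      gaussianSqMoment θ := by
  have hmap : (gaussianReal c v.toNNReal).map (fun s => (s - c) / √v) = gaussianReal 0 1 := by
    have : (fun s => (s - c) / √v) = (fun s => s / √v) ∘ fun s => s - c := rfl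
    rw [this, ← Measure.map_map (by fun_prop) (by fun_prop), gaussianReal_map_sub_const,
      gaussianReal_map_div_const, sub_self, zero_div]
    congr 1
    ext
    simp [Real.sq_sqrt hv.le, Real.coe_toNNReal _ hv.le, hv.ne']
  rw [gaussianSqMoment, ← hmap, lintegral_map (by fun_prop) (by fun_prop)]
  refine lintegral_congr fun s => ?_
  rw [div_pow, Real.sq_sqrt hv.le]
  congr 2
  field_simp

/-- The quadratic deviation of a record's average from `c`. -/
def avgDeviation {m k : ℕ} (W c : Fin m → ℝ) (Y : Record m k) : ℝ :=
  (1 / 2) * ∑ i, (avg Y i - c i) ^ 2 / W i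

lemma measurable_avgDeviation {m k : ℕ} (W c : Fin m → ℝ) :
    Measurable (avgDeviation (k := k) W c) := by
  unfold avgDeviation avg
  fun_prop

/-- Under this law, `k * avgDeviation W c Y` is half a sum of `m` squares of independent standard
Gaussians, so the moment does not depend on `k`. -/
lemma lintegral_exp_avgDeviation {m : ℕ} (c : Fin m → ℝ) {W : Fin m → ℝ} (hW : ∀ i, 0 < W i)
    (θ : ℝ) {k : ℕ} (hk : 0 < k) :
    ∫⁻ Y, ENNReal.ofReal (Real.exp (θ * (k * avgDeviation W c Y))) ∂gaussianRecord c W k =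
      gaussianSqMoment θ ^ m := by
  have hk' : (0 : ℝ) < k := Nat.cast_pos.2 hk
  have h₁ : ∀ Y : Record m k, ENNReal.ofReal (Real.exp (θ * (k * avgDeviation W c Y))) =
      (fun S : Fin m → ℝ => ∏ i, ENNReal.ofReal
        (Real.exp (θ * (S i - k * c i) ^ 2 / (2 * (k * W i))))) (∑ j, Y j) := by
    intro Y
    beta_reduce
    rw [← ENNReal.ofReal_prod_of_nonneg fun i _ => (Real.exp_pos _).le, ← Real.exp_sum]
    congr 2
    rw [avgDeviation, Finset.mul_sum, Finset.mul_sum, Finset.mul_sum]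
    refine Finset.sum_congr rfl fun i _ => ?_
    have := (hW i).ne'
    rw [avg, Finset.sum_apply]
    field_simp
  simp_rw [h₁]
  rw [← lintegral_map (μ := gaussianRecord c W k)
    (f := fun S : Fin m → ℝ => ∏ i, ENNReal.ofReal
        (Real.exp (θ * (S i - k * c i) ^ 2 / (2 * (k * W i))))) (g := fun Y => ∑ j, Y j)
    (by fun_prop) (by fun_prop), gaussianRecord_map_sum c hW, gaussianPi,
    lintegral_pi_prod _ (f := fun i s => ENNReal.ofReal
        (Real.exp (θ * (s - k * c i) ^ 2 / (2 * (k * W i))))) fun i => by fun_prop]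
  rw [Finset.prod_congr rfl fun i _ =>
    lintegral_exp_sq_gaussianReal θ (k * c i) (mul_pos hk' (hW i))]
  simp

/-- Chernoff's bound: Markov's inequality for the exponential moment, which is finite since `θ < 1`.
The prefactor is independent of `k`. -/
lemma gaussianRecord_le_avgDeviation {m : ℕ} (c : Fin m → ℝ) {W : Fin m → ℝ}
    (hW : ∀ i, 0 < W i) {θ : ℝ} (hθ : 0 ≤ θ) (hθ' : θ < 1) (J : ℝ) {k : ℕ} (hk : 0 < k) :
    gaussianRecord c W k {Y | J ≤ avgDeviation W c Y} ≤
      ENNReal.ofReal ((gaussianSqMoment θ ^ m).toReal * Real.exp (-(k * (θ * J)))) := by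
  have hne : gaussianSqMoment θ ^ m ≠ ∞ := ENNReal.pow_ne_top (gaussianSqMoment_lt_top hθ').ne
  have hsub : {Y : Record m k | J ≤ avgDeviation W c Y} ⊆
      {Y | ENNReal.ofReal (Real.exp (k * (θ * J))) ≤
        ENNReal.ofReal (Real.exp (θ * (k * avgDeviation W c Y)))} := by
    intro Y hY
    refine ENNReal.ofReal_le_ofReal (Real.exp_le_exp.2 ?_)
    have h₁ : (0 : ℝ) ≤ k * θ := by positivity
    have h₂ := mul_le_mul_of_nonneg_left (Set.mem_ofPred.1 hY) h₁
    linarith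
  have hmeas := measurable_avgDeviation (k := k) W c
  have hmark := mul_meas_ge_le_lintegral (μ := gaussianRecord c W k)
    (f := fun Y : Record m k => ENNReal.ofReal (Real.exp (θ * (k * avgDeviation W c Y))))
    (by fun_prop) (ENNReal.ofReal (Real.exp (k * (θ * J))))
  rw [lintegral_exp_avgDeviation c hW θ hk] at hmark
  refine (measure_mono hsub).trans ?_
  rw [ENNReal.ofReal_mul ENNReal.toReal_nonneg, ENNReal.ofReal_toReal hne, Real.exp_neg,
    ENNReal.ofReal_inv_of_pos (Real.exp_pos _), ← div_eq_mul_inv]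
  refine (ENNReal.le_div_iff_mul_le (.inl ?_) (.inl ENNReal.ofReal_ne_top)).2 ?_
  · simpa using Real.exp_pos _
  · rwa [mul_comm]

/-! ### Change of measure -/

lemma gaussianReal_eq_withDensity (a b : ℝ) {v : ℝ} (hv : 0 < v) :
    gaussianReal a v.toNNReal = (gaussianReal b v.toNNReal).withDensity fun z =>
      ENNReal.ofReal (Real.exp (((a - b) * (z - b) - (a - b) ^ 2 / 2) / v)) := by
  have hv' : v.toNNReal ≠ 0 := by simpa using hv
  rw [gaussianReal_of_var_ne_zero _ hv', gaussianReal_of_var_ne_zero _ hv',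
    ← withDensity_mul _ (measurable_gaussianPDF _ _) (by fun_prop)]
  congr 1
  ext1 z
  simp only [Pi.mul_apply, gaussianPDF, gaussianPDFReal]
  rw [← ENNReal.ofReal_mul (by positivity), mul_assoc (√(2 * Real.pi * v.toNNReal))⁻¹,
    ← Real.exp_add, Real.coe_toNNReal _ hv.le]
  congr 3
  field_simp
  ring

lemma gaussianPi_eq_withDensity {m : ℕ} (a b : Fin m → ℝ) {W : Fin m → ℝ} (hW : ∀ i, 0 < W i) :
    gaussianPi a W = (gaussianPi b W).withDensity fun z => ENNReal.ofReal
      (Real.exp (∑ i, ((a i - b i) * (z i - b i) - (a i - b i) ^ 2 / 2) / W i)) := by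
  have hd := fun i => gaussianReal_eq_withDensity (a i) (b i) (hW i)
  have : ∀ i, SigmaFinite ((gaussianReal (b i) (W i).toNNReal).withDensity fun z =>
      ENNReal.ofReal (Real.exp (((a i - b i) * (z - b i) - (a i - b i) ^ 2 / 2) / W i))) := by
    intro i; rw [← hd i]; infer_instance
  rw [gaussianPi, funext hd, pi_withDensity _ fun i => by fun_prop]
  congr 1
  ext1 z
  rw [← ENNReal.ofReal_prod_of_nonneg fun i _ => (Real.exp_pos _).le, ← Real.exp_sum]

lemma gaussianRecord_eq_withDensity {m : ℕ} (a b : Fin m → ℝ) {W : Fin m → ℝ}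
    (hW : ∀ i, 0 < W i) (k : ℕ) :
    gaussianRecord a W k = (gaussianRecord b W k).withDensity fun Y => ENNReal.ofReal
      (Real.exp (k * ∑ i, ((a i - b i) * (avg Y i - b i) - (a i - b i) ^ 2 / 2) / W i)) := by
  have hd := gaussianPi_eq_withDensity a b hW
  have : SigmaFinite ((gaussianPi b W).withDensity fun z => ENNReal.ofReal
      (Real.exp (∑ i, ((a i - b i) * (z i - b i) - (a i - b i) ^ 2 / 2) / W i))) := by
    rw [← hd]; infer_instance
  rw [gaussianRecord, hd, pi_withDensity _ fun i => by fun_prop]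
  congr 1
  ext1 Y
  rw [← ENNReal.ofReal_prod_of_nonneg fun i _ => (Real.exp_pos _).le, ← Real.exp_sum]
  congr 2
  rw [Finset.sum_comm, Finset.mul_sum]
  refine Finset.sum_congr rfl fun i _ => ?_
  rcases Nat.eq_zero_or_pos k with rfl | hk
  · simp
  have hk' : (k : ℝ) ≠ 0 := (Nat.cast_pos.2 hk).ne'
  rw [← Finset.sum_div, Finset.sum_sub_distrib, ← Finset.mul_sum, Finset.sum_sub_distrib, avg]
  simp only [Finset.sum_const, Finset.card_univ, Fintype.card_fin, nsmul_eq_mul]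
  field_simp

/-- Under a change of means from `b` to `a`, the probability of an event on which the average is
close to `b` decreases at most exponentially. -/
lemma gaussianRecord_change_mean {m : ℕ} (a b : Fin m → ℝ) {W : Fin m → ℝ}
    (hW : ∀ i, 0 < W i) {φ η s : ℝ} (hs : 0 < s)
    (hφ : (1 / 2) * ∑ i, (a i - b i) ^ 2 / W i ≤ φ) (hsφ : s * φ ≤ η / 2) (k : ℕ)
    (S : Set (Record m k)) :
    ENNReal.ofReal (Real.exp (-(k * (φ + η)))) *
        gaussianRecord b W k (S ∩ {Y | avgDeviation W b Y < s * η / 2}) ≤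
      gaussianRecord a W k S := by
  have hO : MeasurableSet {Y : Record m k | avgDeviation W b Y < s * η / 2} :=
    measurableSet_lt (measurable_avgDeviation W b) measurable_const
  -- Comparing measures restricted to the measurable set of typical records lets `S` be arbitrary;
  -- error events of an estimator need not be measurable.
  have hle : ENNReal.ofReal (Real.exp (-(k * (φ + η)))) •
      (gaussianRecord b W k).restrict {Y | avgDeviation W b Y < s * η / 2} ≤
      gaussianRecord a W k := by
    rw [gaussianRecord_eq_withDensity a b hW, ← withDensity_const,
      ← withDensity_indicator hO]
    refine withDensity_mono (ae_of_all _ fun Y => ?_)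
    by_cases hY : Y ∈ {Y : Record m k | avgDeviation W b Y < s * η / 2}
    · rw [Set.indicator_of_mem hY]
      refine ENNReal.ofReal_le_ofReal (Real.exp_le_exp.2 ?_)
      have hdev : avgDeviation W b Y < s * η / 2 := hY
      -- Young's inequality with weight `s` on the cross term. The part `s * φ` and the deviation
      -- divided by `s` then each cost at most `η / 2`.
      have hterm : ∀ i, -((1 + s) * ((1 / 2) * ((a i - b i) ^ 2 / W i)) +
          s⁻¹ * ((1 / 2) * ((avg Y i - b i) ^ 2 / W i))) ≤
          ((a i - b i) * (avg Y i - b i) - (a i - b i) ^ 2 / 2) / W i := by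
        intro i
        have hsq : 0 ≤ (s * (a i - b i) + (avg Y i - b i)) ^ 2 / (2 * s * W i) := by
          have := hW i; positivity
        have e : ((a i - b i) * (avg Y i - b i) - (a i - b i) ^ 2 / 2) / W i +
            ((1 + s) * ((1 / 2) * ((a i - b i) ^ 2 / W i)) +
              s⁻¹ * ((1 / 2) * ((avg Y i - b i) ^ 2 / W i))) =
            (s * (a i - b i) + (avg Y i - b i)) ^ 2 / (2 * s * W i) := by
          have := (hW i).ne'
          field_simp
          ring
        linarith
      have hsum := Finset.sum_le_sum fun i (_ : i ∈ Finset.univ) => hterm i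
      rw [Finset.sum_neg_distrib, Finset.sum_add_distrib, ← Finset.mul_sum, ← Finset.mul_sum,
        ← Finset.mul_sum, ← Finset.mul_sum] at hsum
      have h₁ : s⁻¹ * avgDeviation W b Y ≤ η / 2 := by
        rw [inv_mul_le_iff₀ hs]; linarith
      unfold avgDeviation at h₁
      have h₂ : (1 + s) * ((1 / 2) * ∑ i, (a i - b i) ^ 2 / W i) ≤ (1 + s) * φ :=
        mul_le_mul_of_nonneg_left hφ (by linarith)
      rw [← mul_neg]
      refine mul_le_mul_of_nonneg_left (le_trans ?_ hsum) (Nat.cast_nonneg k)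
      linarith
    · rw [Set.indicator_of_notMem hY]
      exact zero_le
  have := hle S
  rwa [Measure.smul_apply, smul_eq_mul, Measure.restrict_apply' hO] at this

/-! ### The law of the measurements under an attack -/

section Law

variable {m n : ℕ} {H : Matrix (Fin m) (Fin n) ℝ} {W : Fin m → ℝ} {C : Finset (Fin m)}

lemma measurable_jointLaw_step (k : ℕ) :
    Measurable fun p : ((Record m k × Record m k) × (Fin m → ℝ)) × (Fin m → ℝ) =>
      ((Fin.snoc p.1.1.1 p.1.2 : Record m (k + 1)), (Fin.snoc p.1.1.2 p.2 : Record m (k + 1))) :=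
  ((measurable_snoc k).comp (by fun_prop : Measurable
      fun p : ((Record m k × Record m k) × (Fin m → ℝ)) × (Fin m → ℝ) => (p.1.1.1, p.1.2))).prodMk
    ((measurable_snoc k).comp (by fun_prop : Measurable
      fun p : ((Record m k × Record m k) × (Fin m → ℝ)) × (Fin m → ℝ) => (p.1.1.2, p.2)))

instance (x : State n) : IsProbabilityMeasure (sensorLaw H W x) := by
  unfold sensorLaw; infer_instance

lemma isProbabilityMeasure_jointLaw (g : AttackStrategy C) (x : State n) (k : ℕ) :
    IsProbabilityMeasure (jointLaw H W g x k) := by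
  induction k with
  | zero => unfold jointLaw; infer_instance
  | succ k ih =>
    have := g.isMarkov k
    unfold jointLaw
    exact Measure.isProbabilityMeasure_map (measurable_jointLaw_step k).aemeasurable

/-- The bias kernels are Markov, so they integrate out: no strategy changes the law of the
uncorrupted measurements. -/
lemma jointLaw_map_fst (g : AttackStrategy C) (x : State n) (k : ℕ) :
    (jointLaw H W g x k).map Prod.fst = gaussianRecord (H *ᵥ x.ofLp) W k := by
  induction k with
  | zero =>
    rw [jointLaw, Measure.map_dirac' measurable_fst, gaussianRecord, Measure.pi_of_empty]
    exact congrArg _ (Subsingleton.elim _ _)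
  | succ k ih =>
    have := g.isMarkov k
    have := isProbabilityMeasure_jointLaw (H := H) (W := W) g x k
    rw [jointLaw, Measure.map_map measurable_fst (measurable_jointLaw_step k), gaussianRecord,
      ← pi_prod_map_snoc]
    have hcomp : (Prod.fst ∘
        fun p : ((Record m k × Record m k) × (Fin m → ℝ)) × (Fin m → ℝ) =>
          ((Fin.snoc p.1.1.1 p.1.2 : Record m (k + 1)),
            (Fin.snoc p.1.1.2 p.2 : Record m (k + 1)))) =
        (fun p : Record m k × (Fin m → ℝ) => (Fin.snoc p.1 p.2 : Record m (k + 1))) ∘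
          Prod.map Prod.fst id ∘ Prod.fst := rfl
    rw [hcomp, ← Measure.map_map (measurable_snoc k) (by fun_prop),
      ← Measure.map_map (by fun_prop) measurable_fst]
    change Measure.map _ (Measure.map _ (Measure.fst _)) = _
    rw [Measure.fst_compProd, ← Measure.map_prod_map _ _ measurable_fst measurable_id, ih,
      Measure.map_id]
    rfl

/-- Used twice: with the vectors vanishing off `C` for a general attack, and with a singleton for
the constant one. -/
lemma jointLaw_ae_bias (g : AttackStrategy C) (x : State n) {S : Set (Fin m → ℝ)}
    (hS : MeasurableSet S) (hg : ∀ k h, ∀ᵐ a ∂g.bias k h, a ∈ S) (k : ℕ) :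
    ∀ᵐ p ∂jointLaw H W g x k, ∀ j, p.2 j ∈ S := by
  induction k with
  | zero => exact ae_of_all _ fun p j => j.elim0
  | succ k ih =>
    have := g.isMarkov k
    have := isProbabilityMeasure_jointLaw (H := H) (W := W) g x k
    have hmeas : MeasurableSet {p : Record m (k + 1) × Record m (k + 1) | ∀ j, p.2 j ∈ S} := by
      simp only [Set.ofPred_forall]
      exact MeasurableSet.iInter fun j =>
        ((measurable_pi_apply j).comp measurable_snd) hS
    rw [jointLaw, ae_map_iff (measurable_jointLaw_step k).aemeasurable hmeas]
    refine Measure.ae_compProd_of_ae_ae (measurable_jointLaw_step k hmeas) ?_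
    have hfst : ∀ᵐ r ∂(jointLaw H W g x k).prod (sensorLaw H W x), ∀ j, r.1.2 j ∈ S :=
      Measure.quasiMeasurePreserving_fst.ae ih
    filter_upwards [hfst] with r hr
    filter_upwards [hg k (attackerView C k r)] with a ha
    intro j
    refine Fin.lastCases ?_ (fun j => ?_) j
    · simpa using ha
    · simpa using hr j

lemma measurableSet_forall_notMem_eq_zero (C : Finset (Fin m)) :
    MeasurableSet {a : Fin m → ℝ | ∀ i, i ∉ C → a i = 0} := by
  simp only [Set.ofPred_forall]
  exact MeasurableSet.iInter fun i => MeasurableSet.iInter fun _ =>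
    measurable_pi_apply i (measurableSet_singleton 0)

/-- The attack that adds the same bias `a` at all times. -/
def constantAttack (a : Fin m → ℝ) (ha : ∀ i, i ∉ C → a i = 0) : AttackStrategy C where
  bias _ := Kernel.const _ (Measure.dirac a)
  isMarkov _ := inferInstance
  sparse _ _ := by
    rw [Kernel.const_apply, ae_dirac_iff]
    · exact ha
    · exact measurableSet_forall_notMem_eq_zero C

lemma measurementLaw_constantAttack (a : Fin m → ℝ) (ha : ∀ i, i ∉ C → a i = 0) (x : State n)
    (k : ℕ) : measurementLaw H W (constantAttack a ha) x k =
      gaussianRecord (H *ᵥ x.ofLp + a) W k := by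
  have hae : ∀ᵐ p ∂jointLaw H W (constantAttack a ha) x k, ∀ j, p.2 j ∈ ({a} : Set (Fin m → ℝ)) :=
    jointLaw_ae_bias _ x (measurableSet_singleton a) (fun k h => by
      exact (ae_dirac_iff (p := fun b => b ∈ ({a} : Set (Fin m → ℝ)))
        (measurableSet_singleton a)).2 rfl) k
  rw [measurementLaw, ← gaussianRecord_map_add_const, ← jointLaw_map_fst (constantAttack a ha),
    Measure.map_map (by fun_prop) measurable_fst]
  refine Measure.map_congr ?_
  filter_upwards [hae] with p hp
  have : p.2 = fun _ => a := funext fun j => hp j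
  simp [this]

instance isProbabilityMeasure_measurementLaw (g : AttackStrategy C) (x : State n) (k : ℕ) :
    IsProbabilityMeasure (measurementLaw H W g x k) := by
  have := isProbabilityMeasure_jointLaw (H := H) (W := W) g x k
  exact Measure.isProbabilityMeasure_map (by fun_prop)

/-- No attack makes a large inconsistency of the true state with the average more likely than a
large deviation of the average of the uncorrupted measurements. -/
lemma measurementLaw_le_inconsistency {q : ℕ} (hW : ∀ i, 0 < W i) (hC : C.card ≤ q)
    (g : AttackStrategy C) (x : State n) (J : ℝ) (k : ℕ) :
    measurementLaw H W g x k {Y | J ≤ inconsistency H W q (avg Y) x} ≤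
      gaussianRecord (H *ᵥ x.ofLp) W k {Y | J ≤ avgDeviation W (H *ᵥ x.ofLp) Y} := by
  have hsparse : ∀ᵐ p ∂jointLaw H W g x k, ∀ j, p.2 j ∈ {a : Fin m → ℝ | ∀ i, i ∉ C → a i = 0} :=
    jointLaw_ae_bias g x (measurableSet_forall_notMem_eq_zero C) g.sparse k
  -- The residual off the actual set `C` dominates the inconsistency and depends only on benign
  -- sensors, so the bias drops out of it almost surely.
  have hsub : {Y : Record m k | J ≤ inconsistency H W q (avg Y) x} ⊆
      {Y | J ≤ residualOff H W C (avg Y) x} :=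
    fun Y hY => le_trans (Set.mem_ofPred.1 hY) (inconsistency_le_residualOff hW hC _ _)
  refine (measure_mono hsub).trans ?_
  have hmeas : MeasurableSet {Y : Record m k | J ≤ residualOff H W C (avg Y) x} := by
    refine measurableSet_le measurable_const ?_
    unfold residualOff avg
    fun_prop
  rw [measurementLaw, Measure.map_apply (by fun_prop) hmeas, ← jointLaw_map_fst g,
    Measure.map_apply measurable_fst (measurableSet_le measurable_const (measurable_avgDeviation _ _))]
  refine measure_mono_ae ?_
  filter_upwards [hsparse] with p hp hY
  refine le_trans (Set.mem_ofPred.1 hY) ?_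
  have heq : residualOff H W C (avg (p.1 + p.2)) x = residualOff H W C (avg p.1) x := by
    unfold residualOff
    congr 1
    refine Finset.sum_congr rfl fun i hi => ?_
    have : avg (p.1 + p.2) i = avg p.1 i := by
      unfold avg
      congr 1
      refine Finset.sum_congr rfl fun j _ => ?_
      simp [hp j i (Finset.mem_compl.1 hi)]
    rw [this]
  rw [heq]
  refine (residualOff_anti hW (Finset.empty_subset C) _ _).trans (le_of_eq ?_)
  simp [residualOff, avgDeviation]

end Law

/-! ### Exponential rates -/

section Rate

lemma neg_log_ofReal_mul_exp_div {K : ℝ} (hK : 0 < K) (a : ℝ) (k : ℕ) :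
    -(ENNReal.log (ENNReal.ofReal (K * Real.exp (-(k * a))))) / (k : EReal) =
      (((k * a - Real.log K) / k : ℝ) : EReal) := by
  rw [ENNReal.log_ofReal_of_pos (by positivity), Real.log_mul hK.ne' (Real.exp_pos _).ne',
    Real.log_exp]
  rw [← EReal.coe_neg, ← EReal.coe_natCast, ← EReal.coe_div]
  congr 2
  ring

lemma tendsto_exponent (K a : ℝ) :
    Tendsto (fun k : ℕ => (((k * a - Real.log K) / k : ℝ) : EReal)) atTop (𝓝 (a : EReal)) := by
  refine (continuous_coe_real_ereal.tendsto a).comp ?_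
  have h : Tendsto (fun k : ℕ => a - Real.log K / k) atTop (𝓝 (a - 0)) :=
    tendsto_const_nhds.sub (tendsto_const_div_atTop_nhds_zero_nat _)
  rw [sub_zero] at h
  refine h.congr' ?_
  filter_upwards [eventually_gt_atTop 0] with k hk
  have : (k : ℝ) ≠ 0 := (Nat.cast_pos.2 hk).ne'
  field_simp

variable {m n q : ℕ} {H : Matrix (Fin m) (Fin n) ℝ} {W : Fin m → ℝ}

lemma le_rate_of_worstError_le {f : Estimator m n} {δ K a : ℝ} (hK : 0 < K)
    (h : ∀ᶠ k : ℕ in atTop,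
      worstError H W q f k δ ≤ ENNReal.ofReal (K * Real.exp (-(k * a)))) :
    (a : EReal) ≤ rate H W q f δ := by
  rw [← (tendsto_exponent K a).liminf_eq]
  refine liminf_le_liminf ?_
  filter_upwards [h] with k hk
  rw [← neg_log_ofReal_mul_exp_div hK]
  exact EReal.div_le_div_right_of_nonneg (Nat.cast_nonneg' k)
    (EReal.neg_le_neg_iff.2 (ENNReal.log_le_log hk))

lemma rate_le_of_le_worstError {f : Estimator m n} {δ K a : ℝ} (hK : 0 < K)
    (h : ∀ᶠ k : ℕ in atTop,
      ENNReal.ofReal (K * Real.exp (-(k * a))) ≤ worstError H W q f k δ) :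
    rate H W q f δ ≤ (a : EReal) := by
  rw [← (tendsto_exponent K a).liminf_eq]
  refine liminf_le_liminf ?_
  filter_upwards [h] with k hk
  rw [← neg_log_ofReal_mul_exp_div hK]
  exact EReal.div_le_div_right_of_nonneg (Nat.cast_nonneg' k)
    (EReal.neg_le_neg_iff.2 (ENNReal.log_le_log hk))

lemma rate_eq_top {f : Estimator m n} {δ : ℝ} (h : ∀ k, worstError H W q f k δ = 0) :
    rate H W q f δ = ⊤ := by
  refine top_le_iff.1 (le_trans (le_of_eq tendsto_const_nhds.liminf_eq.symm)
    (liminf_le_liminf (u := fun _ : ℕ => (⊤ : EReal)) (f := atTop) ?_))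
  filter_upwards [eventually_gt_atTop 0] with k hk
  rw [h k, ENNReal.log_zero, EReal.neg_bot, EReal.top_div_of_pos_ne_top (by exact_mod_cast hk)
    (EReal.natCast_ne_top k)]

/-- If all errors of an estimator based on averages come with an inconsistency at least `J`, then
its rate is at least `J`. -/
lemma le_rate_ofAvg (hW : ∀ i, 0 < W i) {h : (Fin m → ℝ) → State n} {δ J : ℝ}
    (hJ : ∀ y x, δ < ‖h y - x‖ → J ≤ inconsistency H W q y x) :
    (J : EReal) ≤ rate H W q (ofAvg h) δ := by
  have hθ : ∀ θ : ℝ, 0 ≤ θ → θ < 1 → ((θ * J : ℝ) : EReal) ≤ rate H W q (ofAvg h) δ := by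
    intro θ hθ hθ'
    -- The summand `1` only keeps the prefactor visibly positive; constant factors do not affect the
    -- rate.
    refine le_rate_of_worstError_le (K := (gaussianSqMoment θ ^ m).toReal + 1) (by positivity) ?_
    filter_upwards [eventually_gt_atTop 0] with k hk
    refine iSup_le fun C => iSup_le fun hC => iSup_le fun g => iSup_le fun x => ?_
    refine (measure_mono fun Y hY => ?_).trans
      ((measurementLaw_le_inconsistency hW hC.le g x J k).trans
        ((gaussianRecord_le_avgDeviation _ hW hθ hθ' J hk).trans
          (ENNReal.ofReal_le_ofReal ?_)))
    · exact hJ _ _ hY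
    · exact mul_le_mul_of_nonneg_right (by linarith) (Real.exp_pos _).le
  -- The Chernoff bound requires `θ < 1`; the full exponent `J` is recovered as `θ = 1 - 1/(k+1)`
  -- tends to `1`.
  have hlim : Tendsto (fun k : ℕ => (((1 - 1 / ((k : ℝ) + 1)) * J : ℝ) : EReal)) atTop
      (𝓝 (J : EReal)) := by
    refine (continuous_coe_real_ereal.tendsto J).comp ?_
    have := (tendsto_const_nhds (x := (1 : ℝ))).sub
      (tendsto_one_div_add_atTop_nhds_zero_nat (𝕜 := ℝ)) |>.mul_const J
    simpa using this
  refine le_of_tendsto hlim (Eventually.of_forall fun k => hθ _ ?_ ?_)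
  · rw [sub_nonneg, div_le_one (by positivity)]
    linarith [Nat.cast_nonneg (α := ℝ) k]
  · have : (0 : ℝ) < 1 / ((k : ℝ) + 1) := by positivity
    linarith

/-- Some attack with a constant bias makes the measurements look as if they had mean `y`, at a cost
given by the inconsistency of the state with `y`. -/
lemma exists_constant_bias (hW : ∀ i, 0 < W i) (hq : q ≤ m) (y : Fin m → ℝ) (x : State n) :
    ∃ (C : Finset (Fin m)) (g : AttackStrategy C) (c : Fin m → ℝ), C.card = q ∧
      (∀ k, measurementLaw H W g x k = gaussianRecord c W k) ∧
      (1 / 2) * ∑ i, (c i - y i) ^ 2 / W i = inconsistency H W q y x := by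
  classical
  obtain ⟨C, hC, hinc⟩ := exists_inconsistency_eq (H := H) hW hq y x
  -- The means of the compromised sensors are moved exactly to `y`, so only benign sensors
  -- contribute to the distance.
  let a : Fin m → ℝ := fun i => if i ∈ C then y i - (H *ᵥ x.ofLp) i else 0
  have ha : ∀ i, i ∉ C → a i = 0 := fun i hi => if_neg hi
  refine ⟨C, constantAttack a ha, _, hC, measurementLaw_constantAttack a ha x, ?_⟩
  rw [hinc, residualOff, ← Finset.sum_compl_add_sum C]
  have h₀ : ∑ i ∈ C, ((H *ᵥ x.ofLp + a) i - y i) ^ 2 / W i = 0 :=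
    Finset.sum_eq_zero fun i hi => by simp [a, hi]
  rw [h₀, add_zero]
  congr 1
  refine Finset.sum_congr rfl fun i hi => ?_
  rw [Pi.add_apply, ha i (Finset.mem_compl.1 hi), add_zero, sub_sq_comm]

/-- A weak law of large numbers from the Chernoff bound; `1 / 2` is an arbitrary choice both for `θ`
and for the probability. -/
lemma gaussianRecord_avgDeviation_lt (c : Fin m → ℝ) (hW : ∀ i, 0 < W i) {J : ℝ} (hJ : 0 < J) :
    ∀ᶠ k : ℕ in atTop,
      ENNReal.ofReal (1 / 2) ≤ gaussianRecord c W k {Y | avgDeviation W c Y < J} := by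
  set K := (gaussianSqMoment (1 / 2) ^ m).toReal with hK
  have hlim : Tendsto (fun k : ℕ => K * Real.exp (-(k * (1 / 2 * J)))) atTop (𝓝 (K * 0)) := by
    refine Tendsto.const_mul K (Real.tendsto_exp_neg_atTop_nhds_zero.comp ?_)
    exact tendsto_natCast_atTop_atTop.atTop_mul_const (by linarith)
  rw [mul_zero] at hlim
  filter_upwards [hlim.eventually_lt_const (show (0 : ℝ) < 1 / 2 by norm_num),
    eventually_gt_atTop 0] with k hk hk0
  have hb := gaussianRecord_le_avgDeviation c hW (θ := 1 / 2) (by norm_num) (by norm_num) J hk0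
  have hb' := hb.trans (ENNReal.ofReal_le_ofReal hk.le)
  have hcompl : {Y : Record m k | avgDeviation W c Y < J} =
      {Y | J ≤ avgDeviation W c Y}ᶜ := by
    ext Y; simp
  rw [hcompl, prob_compl_eq_one_sub
    (measurableSet_le measurable_const (measurable_avgDeviation _ _))]
  refine le_trans (le_of_eq ?_) (tsub_le_tsub_left hb' 1)
  rw [← ENNReal.ofReal_one, ← ENNReal.ofReal_sub _ (by norm_num)]
  norm_num

/-- No estimator has a rate above a level `φ` with `rad 𝒳(y, φ) > δ`. -/
lemma rate_le_of_isInitialUpper (hW : ∀ i, 0 < W i) (hq : q ≤ m) (f : Estimator m n) {δ φ : ℝ}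
    (hδ : 0 < δ) {y : Fin m → ℝ} (hφ : IsInitialUpper (n := n) H W q δ y φ) :
    rate H W q f δ ≤ (φ : EReal) := by
  obtain ⟨F, hF, hfar⟩ := exists_finset_of_lt_rad hδ.le hφ
  have hFne : F.Nonempty := (hfar 0).imp fun x hx => hx.1
  have hcard : (0 : ℝ) < F.card := Nat.cast_pos.2 hFne.card_pos
  have hφ0 : 0 ≤ φ := by
    obtain ⟨x, hx⟩ := hFne
    exact (inconsistency_nonneg hW hq y x).trans (hF x hx)
  refine EReal.le_of_forall_lt_iff_le.1 fun b hb => ?_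
  rw [EReal.coe_lt_coe_iff] at hb
  set η := b - φ with hη
  have hη0 : 0 < η := sub_pos.2 hb
  -- The `+ 1` keeps the denominator positive when `φ = 0`, while still giving `s * φ ≤ η / 2`.
  set s := η / (2 * (φ + 1)) with hs
  have hs0 : 0 < s := by positivity
  have hsφ : s * φ ≤ η / 2 := by
    rw [hs, div_mul_eq_mul_div, div_le_div_iff₀ (by positivity) (by norm_num)]
    nlinarith
  refine rate_le_of_le_worstError (K := 1 / 2 / F.card) (by positivity) ?_
  filter_upwards [gaussianRecord_avgDeviation_lt y hW (show 0 < s * η / 2 by positivity)] with k hk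
  have hb' : b = φ + η := by rw [hη]; ring
  have hx : ∀ x ∈ F, ENNReal.ofReal (Real.exp (-(k * b))) * gaussianRecord y W k
      ({Y | δ < ‖f k Y - x‖} ∩ {Y | avgDeviation W y Y < s * η / 2}) ≤
        worstError H W q f k δ := by
    intro x hx
    obtain ⟨C, g, c, hC, hlaw, hinc⟩ := exists_constant_bias (H := H) hW hq y x
    have := gaussianRecord_change_mean c y hW hs0 (hinc.le.trans (hF x hx)) hsφ k
      {Y | δ < ‖f k Y - x‖}
    rw [← hb', ← hlaw] at this
    exact this.trans (le_iSup_of_le C (le_iSup_of_le hC (le_iSup_of_le g (le_iSup_of_le x le_rfl))))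
  -- No `δ`-ball contains `F`, so on every record the estimate errs for at least one state of `F`.
  have hcover : {Y : Record m k | avgDeviation W y Y < s * η / 2} ⊆
      ⋃ x ∈ F, {Y | δ < ‖f k Y - x‖} ∩ {Y | avgDeviation W y Y < s * η / 2} := by
    intro Y hY
    obtain ⟨x, hx, hd⟩ := hfar (f k Y)
    exact Set.mem_iUnion₂.2 ⟨x, hx, hd, hY⟩
  have hsum : ENNReal.ofReal (Real.exp (-(k * b))) * ENNReal.ofReal (1 / 2) ≤
      F.card * worstError H W q f k δ := by
    calc _ ≤ ENNReal.ofReal (Real.exp (-(k * b))) * ∑ x ∈ F, gaussianRecord y W k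
          ({Y | δ < ‖f k Y - x‖} ∩ {Y | avgDeviation W y Y < s * η / 2}) := by
          gcongr
          exact hk.trans ((measure_mono hcover).trans (measure_biUnion_finset_le _ _))
      _ ≤ ∑ x ∈ F, worstError H W q f k δ := by
          rw [Finset.mul_sum]
          exact Finset.sum_le_sum hx
      _ = _ := by simp
  have hcast : (F.card : ℝ≥0∞) = ENNReal.ofReal F.card := by simp
  rw [div_mul_eq_mul_div, ENNReal.ofReal_div_of_pos hcard, ← hcast]
  refine ENNReal.div_le_of_le_mul' ?_
  rwa [mul_comm, ENNReal.ofReal_mul (Real.exp_pos _).le]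

end Rate

end SecureEstimation

end

theorem theorem3 (m n q : ℕ) (hn : 0 < n)
    (H : Matrix (Fin m) (Fin n) ℝ) (W : Fin m → ℝ) (hW : ∀ i, 0 < W i)
    (hobs : SecureEstimation.SparseObservable H (2 * q))
    (δ ε : ℝ) (hδ : 0 < δ) (hε : 0 < ε) :
    -- the Chebyshev center of `𝕏(y, δ)` is well defined whenever `𝕏(y, δ)` is not empty
    (∀ y : Fin m → ℝ, (SecureEstimation.maxLevelSet H W q y δ).Nonempty →
      ∃! c : SecureEstimation.State n,
        SecureEstimation.IsChebyshevCenter (SecureEstimation.maxLevelSet H W q y δ) c) ∧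
    -- the algorithm can be started on every input, stops, and has exactly one output
    (∀ y : Fin m → ℝ,
      (∃ φ : ℝ, SecureEstimation.IsInitialUpper (n := n) H W q δ y φ) ∧
      ∀ φ : ℝ, SecureEstimation.IsInitialUpper (n := n) H W q δ y φ →
        ∃! x : SecureEstimation.State n,
          SecureEstimation.AlgorithmOutput H W q δ ε y φ x) ∧
    -- the guaranteed performance
    (∀ fstar fhat : (Fin m → ℝ) → SecureEstimation.State n,
      (∀ y, SecureEstimation.IsChebyshevCenter
        (SecureEstimation.maxLevelSet H W q y δ) (fstar y)) →
      (∀ y, ∃ φ : ℝ, SecureEstimation.IsInitialUpper (n := n) H W q δ y φ ∧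
        SecureEstimation.AlgorithmOutput H W q δ ε y φ (fhat y)) →
      SecureEstimation.rate H W q (SecureEstimation.ofAvg fhat) δ ≥
        SecureEstimation.rate H W q (SecureEstimation.ofAvg fstar) δ - (ε : EReal)) := by
  have hq : q ≤ m := by
    have := SecureEstimation.lt_of_sparseObservable hn hobs
    omega
  refine ⟨fun y hy => ?_, fun y => ⟨?_, fun φ _ => ?_⟩, fun fstar fhat _ hhat => ?_⟩
  · exact SecureEstimation.existsUnique_isChebyshevCenter
      (SecureEstimation.isBounded_maxLevelSet hW hn hobs hδ y) hy
  · exact SecureEstimation.exists_isInitialUpper hn hδ y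
  · exact SecureEstimation.existsUnique_algorithmOutput hW hn hobs hδ hε y φ
  · set R := SecureEstimation.rate H W q (SecureEstimation.ofAvg fstar) δ with hR
    -- The converse bound for `fstar` supplies the hypothesis on `R` in the analysis of the
    -- bisection.
    have hbad : ∀ y x, δ < ‖fhat y - x‖ →
        R ≤ ((SecureEstimation.inconsistency H W q y x + ε : ℝ) : EReal) := by
      intro y x hx
      obtain ⟨φ, hφ, hout⟩ := hhat y
      exact SecureEstimation.BisectionOutput.le_inconsistency_add hW hn hobs hδ hε
        (fun ψ hψ => SecureEstimation.rate_le_of_isInitialUpper hW hq _ hδ hψ) hout hφ le_rfl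
        (.inl rfl) hx
    clear_value R
    induction R with
    | bot => simp
    | top =>
      refine le_of_le_of_eq le_top (SecureEstimation.rate_eq_top fun k => ?_).symm
      -- An infinite `R` is incompatible with `hbad` at any far state, so no error can occur.
      have hempty : ∀ x, {Y : SecureEstimation.Record m k |
          δ < ‖SecureEstimation.ofAvg fhat k Y - x‖} = ∅ := fun x =>
        Set.eq_empty_of_forall_notMem fun Y hY =>
          (EReal.coe_lt_top _).not_ge (hbad _ _ hY)
      simp [SecureEstimation.worstError, hempty]
    | coe r =>
      rw [ge_iff_le, ← EReal.coe_sub]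
      refine SecureEstimation.le_rate_ofAvg hW fun y x hx => ?_
      have := EReal.coe_le_coe_iff.1 (hbad y x hx)
      linarith
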